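/- Consider scheduling $m$ tasks on $n\ge 2$ machines, where $m\ge 2(n-1)$. The cost of machine $i$ is a set function $t_i:2^{[m]}\to\mathbb R_{\ge 0}$ with $t_i(\emptyset)=0$ and $t_i(S)\le t_i(T)$ for $S\subseteq T$. It is additive if $t_i(S)=\sum_{j\in S}t_i(\{j\})$ for all $S$; submodular if $t_i(S\cup T)+t_i(S\cap T)\le t_i(S)+t_i(T)$ for all $S,T$; and $\epsilon$-additive if $\bigl|t_i(S)-\sum_{j\in S}t_i(\{j\})\bigr|\le\epsilon$ for all $S$. A deterministic (direct revelation) mechanism maps every reported profile $b=(b_1,\dots,b_n)$ of cost functions to an allocation, that is, a partition of all the tasks into bundles $A_1(b),\dots,A_n(b)$ (possibly empty), and to payments $P_1(b),\dots,P_n(b)\in\mathbb R$ to the machines. For given sets $\mathcal T_i$ of possible cost functions of the machines, it is truthful if $$P_i(t_i,b_{-i})-t_i(A_i(t_i,b_{-i}))\ \ge\ P_i(t_i',b_{-i})-t_i(A_i(t_i',b_{-i}))$$ for all machines $i$, all $t_i,t_i'\in\mathcal T_i$ and all $b_{-i}\in\prod_{k\ne i}\mathcal T_k$. It is $c$-approximate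 on a set of profiles if $\max_i t_i(A_i(t))\le c\cdot\min_{B}\max_i t_i(B_i)$ for every profile $t$ in the set, where $B$ ranges over all allocations. 1. If a deterministic mechanism is truthful when all machines may have arbitrary submodular costs, and is $c$-approximate on all profiles of submodular costs, then $c\ge\sqrt{n-1}$. 2. More strongly, fix a machine $k$. If a deterministic mechanism is truthful when machine $k$ may have an arbitrary submodular cost and all the other machines have additive costs, and is $c$-approximate on all profiles of additive costs, then $c\ge\sqrt{n-1}$. 3. Let moreover $\epsilon>0$. The conclusion of 2 remains true if the mechanism is required to be truthful only when the cost of machine $k$ is both submodular and $\epsilon$-additive and all the other machines have additive costs. 4. The same holds if in 3 "$\epsilon$-additive" is replaced by the multiplicative condition $(1-\epsilon)\sum_{j\in S}t_k(\{j\})\le t_k(S)\le(1+\epsilon)\sum_{j\in S}t_k(\{j\})$ for all $S$. -/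

import Mathlib

namespace Scheduling

/-- A cost function on sets of the `m` tasks. -/
abbrev Cost (m : ℕ) : Type := Finset (Fin m) → ℝ

/-- A profile of cost functions, one for each of the `n` machines. -/
abbrev Profile (n m : ℕ) : Type := Fin n → Cost m

/-- An allocation of all tasks: `a j` is the machine that processes task `j`. -/
abbrev Allocation (n m : ℕ) : Type := Fin m → Fin n

/-- The set of tasks that machine `i` receives. -/
def Allocation.bundle {n m : ℕ} (a : Allocation n m) (i : Fin n) : Finset (Fin m) :=
  Finset.univ.filter fun j => a j = i

/-- Normalized and monotone (hence non-negative) cost functions. -/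
def IsCost {m : ℕ} (v : Cost m) : Prop :=
  v ∅ = 0 ∧ ∀ S T : Finset (Fin m), S ⊆ T → v S ≤ v T

/-- Additive cost functions (with non-negative processing times). -/
def IsAdditive {m : ℕ} (v : Cost m) : Prop :=
  IsCost v ∧ ∀ S : Finset (Fin m), v S = ∑ j ∈ S, v {j}

/-- Normalized monotone submodular cost functions. -/
def IsSubmodular {m : ℕ} (v : Cost m) : Prop :=
  IsCost v ∧ ∀ S T : Finset (Fin m), v (S ∪ T) + v (S ∩ T) ≤ v S + v T

/-- The cost of every set is within `ε` of the sum of the costs of its tasks. -/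
def IsEpsAdditive {m : ℕ} (ε : ℝ) (v : Cost m) : Prop :=
  ∀ S : Finset (Fin m), ∑ j ∈ S, v {j} - ε ≤ v S ∧ v S ≤ ∑ j ∈ S, v {j} + ε

/-- The cost of every set is within a factor `1 ± ε` of the sum of the costs of its tasks. -/
def IsMulEpsAdditive {m : ℕ} (ε : ℝ) (v : Cost m) : Prop :=
  ∀ S : Finset (Fin m),
    (1 - ε) * ∑ j ∈ S, v {j} ≤ v S ∧ v S ≤ (1 + ε) * ∑ j ∈ S, v {j}

/-- A deterministic direct revelation mechanism: an allocation algorithm and payments handed to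
the machines, both depending on the reported profile. Only its behaviour on the domain under
consideration matters; elsewhere it is unconstrained. -/
structure Mechanism (n m : ℕ) where
  alloc : Profile n m → Allocation n m
  pay : Profile n m → Fin n → ℝ

/-- The utility of machine `i` with true cost `v` when the profile `b` is reported. -/
def Mechanism.utility {n m : ℕ} (M : Mechanism n m) (i : Fin n) (v : Cost m)
    (b : Profile n m) : ℝ :=
  M.pay b i - v ((M.alloc b).bundle i)

/-- Truthfulness when the possible types of machine `i` form the set `D i`: whatever the others
report, reporting the true type is at least as good as reporting any other type. In `b`, the
entry `b i` is the true type of machine `i`. -/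
def Mechanism.TruthfulOn {n m : ℕ} (M : Mechanism n m) (D : Fin n → Set (Cost m)) : Prop :=
  ∀ (i : Fin n) (b : Profile n m), (∀ k, b k ∈ D k) → ∀ v ∈ D i,
    M.utility i (b i) (Function.update b i v) ≤ M.utility i (b i) b

/-- The maximum completion time of a machine. -/
noncomputable def makespan {n m : ℕ} (t : Profile n m) (a : Allocation n m) : ℝ :=
  ⨆ i : Fin n, t i (a.bundle i)

/-- The minimum makespan over all allocations. -/
noncomputable def opt {n m : ℕ} (t : Profile n m) : ℝ :=
  ⨅ a : Allocation n m, makespan t a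

/-- The mechanism is `c`-approximate on the profiles with types in `D`. -/
def Mechanism.ApproxOn {n m : ℕ} (M : Mechanism n m) (c : ℝ) (D : Fin n → Set (Cost m)) : Prop :=
  ∀ t : Profile n m, (∀ k, t k ∈ D k) → makespan t (M.alloc t) ≤ c * opt t

/-- Every machine has an additive cost function. -/
def additiveDomain (n m : ℕ) : Fin n → Set (Cost m) :=
  fun _ => {v | IsAdditive v}

/-- Every machine has a submodular cost function. -/
def submodularDomain (n m : ℕ) : Fin n → Set (Cost m) :=
  fun _ => {v | IsSubmodular v}

/-- Machine `k` has a cost function in the class `C`, every other machine is additive. -/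
def oneMachineDomain {n m : ℕ} (k : Fin n) (C : Set (Cost m)) : Fin n → Set (Cost m) :=
  fun i => {v | (i = k → v ∈ C) ∧ (i ≠ k → IsAdditive v)}

end Scheduling

/-! One machine, the root `k`, faces n - 1 leaves. Each leaf owns a first task a and a second task
b, on which the other leaves have prohibitive costs. The core claim (`Grid.root_all`) is that the
root keeps every a at a cost of at least 1 even though each leaf has cost only x₀, just above c, for
its own a. Handing each a to its leaf has makespan at most x₀, so n - 1 ≤ c * x₀, and c ^ 2 < n - 1
is impossible.

The root's costs for the first tasks are raised one leaf at a time (`PairModel.Sound.root_keeps`).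
Let (x, y) be the costs of that leaf i for a and b. The gain is the price of a on top of b, the rent
the price of b alone. Truthfulness of the leaf makes the gain monotone in x and the rent monotone in
y; approximation keeps the rent between roughly y / c and c * y. If the root refused a at a cost γ ≤
Γ < x₀ / c when x = x₀, the gain would be at most Γ for all smaller x. Now consider a root with
costs A and β for a and b, for which a is free on top of b: it takes both or none, according to the
sign of gain + rent - β (`PairModel.Sound.coupled`). Some stretch of y of length about c * Γ < x₀
sees the rent rise by more than Γ. For β in that stretch, the boundary between "both" and "none"
crosses the whole range of x inside a strip lower than it is wide, and it essentially never rises.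
But at each boundary point leaf i changes its mind about a, and changes of one kind lie near a
common line of slope ±1 (`PairModel.Sound.flip_line`). Finitely many kinds cannot cover such a
boundary.

That leaf i is the one affected needs an argument: no approximation is assumed on discounted
profiles, so a third machine might hold a. Let b be free for a set σ of other leaves. For generic
costs (`exists_generic_costs`), whether another leaf holds a does not depend on its own membership
in σ, and for nonempty σ the root does not hold a. Counting the sets σ modulo 2 (`exists_flip`)
shows that leaf i changes its mind for some σ. -/

namespace Scheduling

/-! ### A parity argument -/

/-- Toggling the membership of the value `f σ` in `σ` does not change that value, so it is an
involution without fixed points. -/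
lemma even_card_holder_mem {α : Type*} [DecidableEq α] (O : Finset α) (f : Finset α → α)
    (hf : ∀ σ ⊆ O, ∀ z ∈ O, z ∉ σ → (f σ = z ↔ f (insert z σ) = z)) :
    ∑ _σ ∈ O.powerset.filter (fun σ => f σ ∈ O), (1 : ZMod 2) = 0 := by
  have key : ∀ σ ⊆ O, f σ ∈ O →
      f (if f σ ∈ σ then σ.erase (f σ) else insert (f σ) σ) = f σ := by
    intro σ hσ hm
    split_ifs with h
    · have h1 := hf (σ.erase (f σ)) ((Finset.erase_subset _ _).trans hσ) (f σ) hm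
        (Finset.notMem_erase _ _)
      rw [Finset.insert_erase h] at h1
      exact h1.2 rfl
    · exact (hf σ hσ (f σ) hm h).1 rfl
  refine Finset.sum_involution
    (fun (σ : Finset α) _ => if f σ ∈ σ then σ.erase (f σ) else insert (f σ) σ) ?_ ?_ ?_ ?_
  · intro σ hσ; exact CharTwo.add_self_eq_zero (R := ZMod 2) 1
  · intro σ hσ _ heq
    split_ifs at heq with h
    · exact Finset.notMem_erase (f σ) σ (by rw [heq]; exact h)
    · have hm := Finset.mem_insert_self (f σ) σ
      rw [heq] at hm
      exact h hm
  · intro σ hσ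
    rw [Finset.mem_filter, Finset.mem_powerset] at hσ ⊢
    refine ⟨?_, by rw [key σ hσ.1 hσ.2]; exact hσ.2⟩
    split_ifs with h
    · exact (Finset.erase_subset _ _).trans hσ.1
    · exact Finset.insert_subset hσ.2 hσ.1
  · intro σ hσ
    rw [Finset.mem_filter, Finset.mem_powerset] at hσ
    simp only [key σ hσ.1 hσ.2]
    by_cases h : f σ ∈ σ
    · simp [h]
    · simp [h]

/-- If `u` never takes the value `k` and `v` takes it exactly at `∅`, and the other values are
invariant under toggling, then `u` and `v` take the value `i` at different places. -/
lemma exists_flip {α : Type*} [DecidableEq α] (O : Finset α) (i k : α) (hik : i ≠ k)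
    (hi : i ∉ O) (hk : k ∉ O) (hall : ∀ z, z ≠ i → z ≠ k → z ∈ O) (u v : Finset α → α)
    (hu : ∀ σ ⊆ O, ∀ z ∈ O, z ∉ σ → (u σ = z ↔ u (insert z σ) = z))
    (hv : ∀ σ ⊆ O, ∀ z ∈ O, z ∉ σ → (v σ = z ↔ v (insert z σ) = z))
    (huk : ∀ σ ⊆ O, u σ ≠ k) (hvk : ∀ σ ⊆ O, σ.Nonempty → v σ ≠ k) (hv0 : v ∅ = k) :
    ∃ σ ⊆ O, ¬ (u σ = i ↔ v σ = i) := by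
  by_contra! hcon
  have h1 := even_card_holder_mem O u hu
  have h2 := even_card_holder_mem O v hv
  -- If `u` and `v` took the value `i` at the same sets, the families where they take values in `O`
  -- would differ by `∅` alone, against parity.
  have hsplit : O.powerset.filter (fun σ => u σ ∈ O) =
      insert ∅ (O.powerset.filter (fun σ => v σ ∈ O)) := by
    ext σ
    simp only [Finset.mem_insert, Finset.mem_filter, Finset.mem_powerset]
    constructor
    · rintro ⟨hσ, hm⟩
      rcases Finset.eq_empty_or_nonempty σ with h | h
      · exact Or.inl h
      · refine Or.inr ⟨hσ, hall _ (fun e => hi ?_) (hvk σ hσ h)⟩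
        rw [← (hcon σ hσ).2 e]; exact hm
    · rintro (rfl | ⟨hσ, hm⟩)
      · refine ⟨Finset.empty_subset _, hall _ (fun e => hik ?_) (huk _ (Finset.empty_subset _))⟩
        rw [← hv0]; exact ((hcon ∅ (Finset.empty_subset _)).1 e).symm
      · refine ⟨hσ, hall _ (fun e => hi ?_) (huk _ hσ)⟩
        rw [← (hcon σ hσ).1 e]; exact hm
  rw [hsplit, Finset.sum_insert, h2] at h1
  · exact absurd h1 (by decide)
  · simp [hv0, hk]

/-! ### Two tasks, one distinguished leaf -/

/-- What a mechanism does with two tasks `a`, `b` when everything is fixed except the type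
`(ta, tb, d)` of the root `k` on these tasks (`d` is the discount on the pair), the costs `(x, y)`
of the leaf `i`, and the set `σ` of the other leaves that can process `b` at no cost: `hA` and `hB`
are the machines that receive `a` and `b`, `pay` is the payment to the root net of its cost on the
remaining tasks. -/
structure PairModel (n : ℕ) where
  hA : ℝ → ℝ → ℝ → ℝ → ℝ → Finset (Fin n) → Fin n
  hB : ℝ → ℝ → ℝ → ℝ → ℝ → Finset (Fin n) → Fin n
  pay : ℝ → ℝ → ℝ → ℝ → ℝ → Finset (Fin n) → ℝ

/-- The cost of the root of the part of the pair that it receives. -/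
def pairLoad {n : ℕ} (k : Fin n) (ta tb d : ℝ) (p q : Fin n) : ℝ :=
  (if p = k then ta else 0) + (if q = k then tb else 0) - (if p = k ∧ q = k then d else 0)

/-- The admissible root types on a pair of tasks. -/
def PairType (ε E ta tb d : ℝ) : Prop :=
  0 ≤ ta ∧ 0 ≤ tb ∧ (d = 0 ∨ (d = ta ∧ ta ≤ E ∧ ta ≤ ε * tb))

/-- Truthfulness of the root and of the leaf `i`, and approximation on additive types, where `C`
bounds the cost of the root on the remaining tasks and `h` is a lower bound for the costs of the
other leaves. -/
structure PairModel.Sound {n : ℕ} (G : PairModel n) (k i : Fin n) (ε E c C h : ℝ) : Prop where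
  root : ∀ ta tb d ta' tb' d' x y σ, PairType ε E ta tb d → PairType ε E ta' tb' d' →
    0 ≤ x → 0 ≤ y → k ∉ σ → i ∉ σ →
    G.pay ta' tb' d' x y σ - pairLoad k ta tb d (G.hA ta' tb' d' x y σ) (G.hB ta' tb' d' x y σ) ≤
    G.pay ta tb d x y σ - pairLoad k ta tb d (G.hA ta tb d x y σ) (G.hB ta tb d x y σ)
  leaf : ∀ ta tb d x y x' y' σ, PairType ε E ta tb d → 0 ≤ x → 0 ≤ y → 0 ≤ x' → 0 ≤ y' →
    k ∉ σ → i ∉ σ →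
    (x - x') * ((if G.hA ta tb d x y σ = i then 1 else 0) -
        (if G.hA ta tb d x' y' σ = i then 1 else 0)) +
      (y - y') * ((if G.hB ta tb d x y σ = i then 1 else 0) -
        (if G.hB ta tb d x' y' σ = i then 1 else 0)) ≤ 0
  approx : ∀ ta tb x y σ O, 0 ≤ ta → 0 ≤ tb → 0 ≤ x → 0 ≤ y → k ∉ σ → i ∉ σ →
    (C + x + tb ≤ O ∨ C + x + y ≤ O ∨ (σ.Nonempty ∧ C + x ≤ O)) →
    (G.hA ta tb 0 x y σ = k → ta ≤ c * O) ∧ (G.hA ta tb 0 x y σ = i → x ≤ c * O) ∧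
    (G.hA ta tb 0 x y σ ≠ k → G.hA ta tb 0 x y σ ≠ i → h ≤ c * O) ∧
    (G.hB ta tb 0 x y σ = k → tb ≤ c * O) ∧ (G.hB ta tb 0 x y σ = i → y ≤ c * O) ∧
    (G.hB ta tb 0 x y σ ≠ k → G.hB ta tb 0 x y σ ≠ i → G.hB ta tb 0 x y σ ∉ σ → h ≤ c * O)

/-- Inequalities between the constants of the construction. -/
structure Scales (ε E c C x₀ κ A Y Y' h : ℝ) : Prop where
  hc : 1 ≤ c
  hC : 0 ≤ C
  hx₀ : 0 ≤ x₀
  hκ : 0 < κ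
  hκ1 : κ ≤ 1
  hA : c * (C + x₀ + 1) + 1 < A
  hE : A ≤ E
  hY : c * (C + x₀ + 1) < Y
  hh : c * (C + x₀ + 1 + Y') < h
  hYY : Y ≤ Y'

lemma PairType.additive {ε E ta tb : ℝ} (ha : 0 ≤ ta) (hb : 0 ≤ tb) : PairType ε E ta tb 0 :=
  ⟨ha, hb, Or.inl rfl⟩

/-! ### Prices of the two tasks and their monotonicity -/

section Model

variable {n : ℕ} {G : PairModel n} {k i : Fin n} {ε E c C x₀ κ A Y Y' h : ℝ}

/-- Giving a to the leaf and the rest to the root has makespan at most C + x + κ; compared with it,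
both y ≥ Y and h break the ratio. -/
lemma PairModel.Sound.light_b (S : G.Sound k i ε E c C h) (P : Scales ε E c C x₀ κ A Y Y' h)
    {α x y : ℝ} (hα : 0 ≤ α) (hx : 0 ≤ x) (hx' : x ≤ x₀) (hy : Y ≤ y) :
    G.hB α κ 0 x y ∅ = k ∧ (G.hA α κ 0 x y ∅ = k ∨ G.hA α κ 0 x y ∅ = i) := by
  have hc := P.hc; have hC := P.hC; have h1 := P.hκ; have h2 := P.hκ1
  have h3 := P.hY; have h4 := P.hh; have h5 := P.hYY
  have hY0 : 0 ≤ Y := le_trans (by positivity [P.hx₀]) h3.le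
  have hO : c * (C + x + κ) ≤ c * (C + x₀ + 1) := by gcongr
  have hO' : c * (C + x₀ + 1) ≤ c * (C + x₀ + 1 + Y') :=
    mul_le_mul_of_nonneg_left (by linarith) (by linarith)
  obtain ⟨-, -, q3, -, q5, q6⟩ := S.approx α κ x y ∅ (C + x + κ) hα h1.le hx (by linarith)
    (by simp) (by simp) (Or.inl le_rfl)
  refine ⟨?_, ?_⟩
  · by_contra hk
    by_cases hi : G.hB α κ 0 x y ∅ = i
    · linarith [q5 hi]
    · linarith [q6 hk hi (by simp)]
  · by_contra! hk
    linarith [q3 hk.1 hk.2]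

lemma PairModel.Sound.heavy_a (S : G.Sound k i ε E c C h) (P : Scales ε E c C x₀ κ A Y Y' h)
    {β x y : ℝ} (hβ : 0 ≤ β) (hx : 0 ≤ x) (hx' : x ≤ x₀) (hy : 0 ≤ y) (hy' : y ≤ Y') :
    G.hA h β 0 x y ∅ = i ∧ (G.hB h β 0 x y ∅ = k ∨ G.hB h β 0 x y ∅ = i) := by
  have hc := P.hc; have hC := P.hC
  have h4 := P.hh; have h0 := P.hx₀
  have hO : c * (C + x + y) ≤ c * (C + x₀ + 1 + Y') :=
    mul_le_mul_of_nonneg_left (by linarith) (by linarith)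
  have hh0 : 0 ≤ h := by
    have : 0 ≤ c * (C + x₀ + 1 + Y') := by
      have : 0 ≤ Y' := hy.trans hy'
      positivity
    linarith
  obtain ⟨q1, -, q3, -, q5, q6⟩ := S.approx h β x y ∅ (C + x + y) hh0 hβ hx hy
    (by simp) (by simp) (Or.inr (Or.inl le_rfl))
  refine ⟨?_, ?_⟩
  · by_contra hi
    by_cases hk : G.hA h β 0 x y ∅ = k
    · linarith [q1 hk]
    · linarith [q3 hk hi]
  · by_contra! hk
    linarith [q6 hk.1 hk.2 (by simp)]

/-- For large y the cost α need not break the ratio by itself. It does when the leaf has costs (x₀ +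
1, 0), where the leaf gets both tasks. It gets b at (x, y) too, so truthfulness leaves it a at the
smaller cost x. -/
lemma PairModel.Sound.heavy_ab (S : G.Sound k i ε E c C h) (P : Scales ε E c C x₀ κ A Y Y' h)
    (hik : i ≠ k) {α x y : ℝ} (hα : c * (C + x₀ + 1) < α) (hx : 0 ≤ x) (hx' : x ≤ x₀) (hy : 0 ≤ y)
    (hy' : y ≤ Y') : G.hA α h 0 x y ∅ ≠ k ∧ G.hB α h 0 x y ∅ = i := by
  have hc := P.hc; have hC := P.hC; have h0 := P.hx₀
  have h4 := P.hh
  have hY0 : 0 ≤ Y' := hy.trans hy'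
  have hα0 : 0 ≤ α := le_trans (by positivity) hα.le
  have hO : c * (C + x + y) ≤ c * (C + x₀ + 1 + Y') :=
    mul_le_mul_of_nonneg_left (by linarith) (by linarith)
  have hO' : c * (C + (x₀ + 1) + 0) ≤ c * (C + x₀ + 1 + Y') :=
    mul_le_mul_of_nonneg_left (by linarith) (by linarith)
  have hO'' : c * (C + (x₀ + 1) + 0) = c * (C + x₀ + 1) := by ring
  have hh0 : 0 ≤ h := le_trans (by positivity) h4.le
  obtain ⟨-, -, -, q4, -, q6⟩ := S.approx α h x y ∅ (C + x + y) hα0 hh0 hx hy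
    (by simp) (by simp) (Or.inr (Or.inl le_rfl))
  obtain ⟨p1, -, p3, p4, -, p6⟩ := S.approx α h (x₀ + 1) 0 ∅ (C + (x₀ + 1) + 0) hα0 hh0
    (by linarith) le_rfl (by simp) (by simp) (Or.inr (Or.inl le_rfl))
  have hB : G.hB α h 0 x y ∅ = i := by
    by_contra hi
    by_cases hk : G.hB α h 0 x y ∅ = k
    · linarith [q4 hk]
    · linarith [q6 hk hi (by simp)]
  have hB' : G.hB α h 0 (x₀ + 1) 0 ∅ = i := by
    by_contra hi
    by_cases hk : G.hB α h 0 (x₀ + 1) 0 ∅ = k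
    · linarith [p4 hk]
    · linarith [p6 hk hi (by simp)]
  have hA' : G.hA α h 0 (x₀ + 1) 0 ∅ = i := by
    by_contra hi
    by_cases hk : G.hA α h 0 (x₀ + 1) 0 ∅ = k
    · linarith [p1 hk]
    · linarith [p3 hk hi]
  refine ⟨fun hk => ?_, hB⟩
  have := S.leaf α h 0 x y (x₀ + 1) 0 ∅ (PairType.additive hα0 hh0) hx hy (by linarith) le_rfl
    (by simp) (by simp)
  rw [hB, hB', hA', hk] at this
  simp only [hik.symm, if_true, if_false] at this
  linarith

/-- The value of `a` for a root that receives `b`. -/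
def PairModel.gain (G : PairModel n) (κ h x y : ℝ) : ℝ := G.pay κ κ 0 x y ∅ - G.pay h κ 0 x y ∅

/-- The value of `b` for a root that does not receive `a`. -/
def PairModel.rent (G : PairModel n) (κ h x y : ℝ) : ℝ := G.pay h κ 0 x y ∅ - G.pay h h 0 x y ∅

lemma Scales.nonneg_h (P : Scales ε E c C x₀ κ A Y Y' h) : 0 ≤ h := by
  have hc := P.hc; have hC := P.hC; have h0 := P.hx₀
  have h3 := P.hY; have h5 := P.hYY
  have : 0 ≤ c * (C + x₀ + 1) := by positivity
  have : 0 ≤ c * (C + x₀ + 1 + Y') := by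
    have : 0 ≤ Y' := by linarith
    positivity
  linarith [P.hh]

lemma Scales.nonneg_Y (P : Scales ε E c C x₀ κ A Y Y' h) : 0 ≤ Y := by
  have hc := P.hc; have hC := P.hC; have h0 := P.hx₀
  have : 0 ≤ c * (C + x₀ + 1) := by positivity
  linarith [P.hY]

lemma PairModel.Sound.ref_b (S : G.Sound k i ε E c C h) (P : Scales ε E c C x₀ κ A Y Y' h)
    {x y : ℝ} (hx : 0 ≤ x) (hx' : x ≤ x₀) (hy : Y ≤ y) (hy' : y ≤ Y') :
    G.hA h κ 0 x y ∅ = i ∧ G.hB h κ 0 x y ∅ = k :=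
  ⟨(S.heavy_a P P.hκ.le hx hx' (P.nonneg_Y.trans hy) hy').1,
    (S.light_b P P.nonneg_h hx hx' hy).1⟩

lemma PairModel.Sound.ref_none (S : G.Sound k i ε E c C h) (P : Scales ε E c C x₀ κ A Y Y' h)
    (hik : i ≠ k) {x y : ℝ} (hx : 0 ≤ x) (hx' : x ≤ x₀) (hy : 0 ≤ y) (hy' : y ≤ Y') :
    G.hA h h 0 x y ∅ = i ∧ G.hB h h 0 x y ∅ = i := by
  refine ⟨(S.heavy_a P P.nonneg_h hx hx' hy hy').1, (S.heavy_ab P hik ?_ hx hx' hy hy').2⟩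
  have hc := P.hc
  have : c * (C + x₀ + 1) ≤ c * (C + x₀ + 1 + Y') := by
    have : 0 ≤ Y' := hy.trans hy'
    exact mul_le_mul_of_nonneg_left (by linarith) (by linarith)
  linarith [P.hh]

/-- Since κ is tiny the root owns b in any case, so its decision on a compares α with a difference
of prices. The hypothesis `hab` makes the payment at (κ, κ) the price of both tasks. -/
lemma PairModel.Sound.gain_of_light (S : G.Sound k i ε E c C h)
    (P : Scales ε E c C x₀ κ A Y Y' h) (hik : i ≠ k) {α x y : ℝ} (hα : 0 ≤ α) (hx : 0 ≤ x)
    (hx' : x ≤ x₀) (hy : Y ≤ y) (hy' : y ≤ Y')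
    (hab : G.hA κ κ 0 x y ∅ = k ∧ G.hB κ κ 0 x y ∅ = k) :
    (G.hA α κ 0 x y ∅ = k → α ≤ G.gain κ h x y) ∧
    (G.hA α κ 0 x y ∅ ≠ k → G.gain κ h x y ≤ α) := by
  have hy0 := P.nonneg_Y.trans hy
  have tα : PairType ε E α κ 0 := PairType.additive hα P.hκ.le
  have tκ : PairType ε E κ κ 0 := PairType.additive P.hκ.le P.hκ.le
  have th : PairType ε E h κ 0 := PairType.additive P.nonneg_h P.hκ.le
  obtain ⟨b1, b2⟩ := S.ref_b P hx hx' hy hy'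
  have hb := (S.light_b P hα hx hx' hy).1
  unfold PairModel.gain
  constructor <;> intro ha
  · have e := S.root _ _ _ _ _ _ x y ∅ tα th hx hy0 (by simp) (by simp)
    have e' := S.root _ _ _ _ _ _ x y ∅ tκ tα hx hy0 (by simp) (by simp)
    simp only [pairLoad, b1, b2, ha, hb, hab.1, hab.2, hik, if_true, if_false, and_self,
      false_and] at e e'
    linarith
  · have e := S.root _ _ _ _ _ _ x y ∅ tα tκ hx hy0 (by simp) (by simp)
    have e' := S.root _ _ _ _ _ _ x y ∅ th tα hx hy0 (by simp) (by simp)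
    simp only [pairLoad, b1, b2, ha, hb, hab.1, hab.2, hik, if_true, if_false, and_self,
      false_and] at e e'
    linarith

lemma PairModel.Sound.rent_of_heavy (S : G.Sound k i ε E c C h)
    (P : Scales ε E c C x₀ κ A Y Y' h) (hik : i ≠ k) {β x y : ℝ} (hβ : 0 ≤ β) (hx : 0 ≤ x)
    (hx' : x ≤ x₀) (hy : Y ≤ y) (hy' : y ≤ Y') :
    (G.hB h β 0 x y ∅ = k → β ≤ G.rent κ h x y) ∧
    (G.hB h β 0 x y ∅ ≠ k → G.rent κ h x y ≤ β) := by
  have hy0 := P.nonneg_Y.trans hy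
  have tβ : PairType ε E h β 0 := PairType.additive P.nonneg_h hβ
  have th : PairType ε E h κ 0 := PairType.additive P.nonneg_h P.hκ.le
  have tn : PairType ε E h h 0 := PairType.additive P.nonneg_h P.nonneg_h
  obtain ⟨b1, b2⟩ := S.ref_b P hx hx' hy hy'
  obtain ⟨n1, n2⟩ := S.ref_none P hik hx hx' hy0 hy'
  have ha := (S.heavy_a P hβ hx hx' hy0 hy').1
  unfold PairModel.rent
  constructor <;> intro hb
  · have e := S.root _ _ _ _ _ _ x y ∅ tβ tn hx hy0 (by simp) (by simp)
    have e' := S.root _ _ _ _ _ _ x y ∅ th tβ hx hy0 (by simp) (by simp)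
    simp only [pairLoad, b1, b2, n1, n2, ha, hb, hik, if_true, if_false, and_self,
      false_and] at e e'
    linarith
  · have e := S.root _ _ _ _ _ _ x y ∅ tβ th hx hy0 (by simp) (by simp)
    have e' := S.root _ _ _ _ _ _ x y ∅ tn tβ hx hy0 (by simp) (by simp)
    simp only [pairLoad, b1, b2, n1, n2, ha, hb, hik, if_true, if_false, and_self,
      false_and] at e e'
    linarith

lemma PairModel.Sound.le_gain (S : G.Sound k i ε E c C h)
    (P : Scales ε E c C x₀ κ A Y Y' h) (hik : i ≠ k) {x y : ℝ} (hx : 0 ≤ x)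
    (hx' : x ≤ x₀) (hy : Y ≤ y) (hy' : y ≤ Y')
    (hab : G.hA κ κ 0 x y ∅ = k ∧ G.hB κ κ 0 x y ∅ = k) : κ ≤ G.gain κ h x y :=
  (S.gain_of_light P hik P.hκ.le hx hx' hy hy' hab).1 hab.1

/-- At a cost α strictly between the two gains, the root would take a at (x, y) but leave it to the
leaf at (x', y'), although x < x'. The root holds b both times, so y and y' play no role. -/
lemma PairModel.Sound.gain_mono (S : G.Sound k i ε E c C h)
    (P : Scales ε E c C x₀ κ A Y Y' h) (hik : i ≠ k) {x y x' y' : ℝ} (hx : 0 ≤ x)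
    (hxx : x < x') (hx' : x' ≤ x₀) (hy : Y ≤ y) (hyY : y ≤ Y') (hy' : Y ≤ y') (hyY' : y' ≤ Y')
    (hab : G.hA κ κ 0 x y ∅ = k ∧ G.hB κ κ 0 x y ∅ = k)
    (hab' : G.hA κ κ 0 x' y' ∅ = k ∧ G.hB κ κ 0 x' y' ∅ = k) :
    G.gain κ h x y ≤ G.gain κ h x' y' := by
  by_contra! hlt
  obtain ⟨α, h1, h2⟩ := exists_between hlt
  have hx0' : 0 ≤ x' := by linarith
  have hα : 0 ≤ α := by linarith [S.le_gain P hik hx0' hx' hy' hyY' hab', P.hκ]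
  have g1 := S.gain_of_light P hik hα hx (by linarith) hy hyY hab
  have g2 := S.gain_of_light P hik hα hx0' hx' hy' hyY' hab'
  have a1 : G.hA α κ 0 x y ∅ = k := by by_contra hk; linarith [g1.2 hk]
  have a2 : G.hA α κ 0 x' y' ∅ ≠ k := fun hk => by linarith [g2.1 hk]
  obtain ⟨b1, -⟩ := S.light_b P hα hx (by linarith) hy
  obtain ⟨b2, c2⟩ := S.light_b P hα hx0' hx' hy'
  have a2' := c2.resolve_left a2
  have := S.leaf α κ 0 x y x' y' ∅ (PairType.additive hα P.hκ.le) hx (P.nonneg_Y.trans hy) hx0'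
    (P.nonneg_Y.trans hy') (by simp) (by simp)
  rw [a1, b1, a2', b2] at this
  simp only [hik.symm, if_true, if_false] at this
  linarith

/-- The leaf cannot take b without breaking the ratio while β is below about y / c. Together with
`rent_le` this pins the growth of the rent. -/
lemma PairModel.Sound.le_rent (S : G.Sound k i ε E c C h)
    (P : Scales ε E c C x₀ κ A Y Y' h) (hik : i ≠ k) {β x y : ℝ} (hβ : 0 ≤ β) (hx : 0 ≤ x)
    (hx' : x ≤ x₀) (hy : Y ≤ y) (hy' : y ≤ Y') (hlt : c * (C + x₀ + β) < y) :
    β ≤ G.rent κ h x y := by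
  refine (S.rent_of_heavy P hik hβ hx hx' hy hy').1 ?_
  have hy0 := P.nonneg_Y.trans hy
  have hc := P.hc
  have hO : c * (C + x + β) ≤ c * (C + x₀ + β) := by gcongr
  by_contra hk
  have hi := (S.heavy_a P hβ hx hx' hy0 hy').2.resolve_left hk
  have := (S.approx h β x y ∅ (C + x + β) P.nonneg_h hβ hx hy0 (by simp) (by simp)
    (Or.inl le_rfl)).2.2.2.2.1 hi
  linarith

lemma PairModel.Sound.rent_le (S : G.Sound k i ε E c C h)
    (P : Scales ε E c C x₀ κ A Y Y' h) (hik : i ≠ k) {x y : ℝ} (hx : 0 ≤ x)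
    (hx' : x ≤ x₀) (hy : Y ≤ y) (hy' : y ≤ Y') :
    G.rent κ h x y ≤ c * (C + x₀ + y) + 1 := by
  have hy0 := P.nonneg_Y.trans hy
  have hc := P.hc; have hC := P.hC; have h0 := P.hx₀
  have hβ : 0 ≤ c * (C + x₀ + y) + 1 := by positivity
  refine (S.rent_of_heavy P hik hβ hx hx' hy hy').2 fun hk => ?_
  have := (S.approx h _ x y ∅ (C + x + y) P.nonneg_h hβ hx hy0 (by simp) (by simp)
    (Or.inr (Or.inl le_rfl))).2.2.2.1 hk
  have hO : c * (C + x + y) ≤ c * (C + x₀ + y) := by gcongr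
  linarith

/-- The argument of `gain_mono` for b: the cost h of a leaves it with the leaf throughout, so x and
x' play no role. -/
lemma PairModel.Sound.rent_mono (S : G.Sound k i ε E c C h)
    (P : Scales ε E c C x₀ κ A Y Y' h) (hik : i ≠ k) {x y x' y' : ℝ} (hx : 0 ≤ x) (hxx : x ≤ x₀)
    (hx0' : 0 ≤ x') (hx' : x' ≤ x₀) (hy : Y ≤ y) (hyy : y < y') (hy' : y' ≤ Y') :
    G.rent κ h x y ≤ G.rent κ h x' y' := by
  by_contra! hlt
  obtain ⟨β, h1, h2⟩ := exists_between hlt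
  have hY1 : Y ≤ y' := by linarith
  have hY0 := P.nonneg_Y
  have hβ : 0 ≤ β := by
    have := S.le_rent P hik le_rfl hx0' hx' hY1 hy' (by
      have := P.hY; have hc := P.hc
      have : c * (C + x₀ + 0) ≤ c * (C + x₀ + 1) := by gcongr; norm_num
      linarith)
    linarith
  have g1 := S.rent_of_heavy P hik hβ hx hxx hy (by linarith)
  have g2 := S.rent_of_heavy P hik hβ hx0' hx' hY1 hy'
  have b1 : G.hB h β 0 x y ∅ = k := by by_contra hk; linarith [g1.2 hk]
  have b2 : G.hB h β 0 x' y' ∅ ≠ k := fun hk => by linarith [g2.1 hk]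
  obtain ⟨a1, -⟩ := S.heavy_a P hβ hx hxx (by linarith) (by linarith : y ≤ Y')
  obtain ⟨a2, c2⟩ := S.heavy_a P hβ hx0' hx' (by linarith) hy'
  have b2' := c2.resolve_left b2
  have := S.leaf h β 0 x y x' y' ∅ (PairType.additive P.nonneg_h hβ) hx (by linarith) hx0'
    (by linarith) (by simp) (by simp)
  rw [a1, b1, a2, b2'] at this
  simp only [hik.symm, if_true, if_false] at this
  linarith

/-- A root to which `a` is free on top of `b` receives both or none of the two tasks, according to
whether the sum of the gain and the rent is large or small. -/
lemma PairModel.Sound.coupled (S : G.Sound k i ε E c C h)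
    (P : Scales ε E c C x₀ κ A Y Y' h) (hik : i ≠ k) {β x y : ℝ} (hβ : 0 ≤ β) (hAβ : A ≤ ε * β)
    (hx : 0 ≤ x) (hx' : x ≤ x₀) (hy : Y ≤ y) (hy' : y ≤ Y')
    (hab : G.hA κ κ 0 x y ∅ = k ∧ G.hB κ κ 0 x y ∅ = k) :
    (G.hA A β A x y ∅ = k → β ≤ G.gain κ h x y + G.rent κ h x y) ∧
    (G.hA A β A x y ∅ ≠ k → G.gain κ h x y + G.rent κ h x y ≤ β) := by
  have hy0 := P.nonneg_Y.trans hy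
  have hc := P.hc; have hC := P.hC; have h0 := P.hx₀
  have hO0 : 0 ≤ c * (C + x₀ + 1) := by positivity
  have hA0 : 0 ≤ A := by linarith [P.hA]
  have hA1 : 0 ≤ A - 1 := by linarith [P.hA]
  have tc : PairType ε E A β A := ⟨hA0, hβ, Or.inr ⟨rfl, P.hE, hAβ⟩⟩
  have tκ : PairType ε E κ κ 0 := PairType.additive P.hκ.le P.hκ.le
  have th : PairType ε E h κ 0 := PairType.additive P.nonneg_h P.hκ.le
  have tn : PairType ε E h h 0 := PairType.additive P.nonneg_h P.nonneg_h
  have ta : PairType ε E (A - 1) h 0 := PairType.additive hA1 P.nonneg_h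
  obtain ⟨b1, b2⟩ := S.ref_b P hx hx' hy hy'
  obtain ⟨n1, n2⟩ := S.ref_none P hik hx hx' hy0 hy'
  obtain ⟨m1, m2⟩ := S.heavy_ab P hik (by linarith [P.hA] : c * (C + x₀ + 1) < A - 1) hx hx' hy0 hy'
  have hg := S.le_gain P hik hx hx' hy hy' hab
  have hκ := P.hκ
  unfold PairModel.gain at hg ⊢
  unfold PairModel.rent
  have r1 := S.root _ _ _ _ _ _ x y ∅ tc tκ hx hy0 (by simp) (by simp)
  have r2 := S.root _ _ _ _ _ _ x y ∅ tκ tc hx hy0 (by simp) (by simp)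
  have r3 := S.root _ _ _ _ _ _ x y ∅ th tc hx hy0 (by simp) (by simp)
  have r4 := S.root _ _ _ _ _ _ x y ∅ tn tc hx hy0 (by simp) (by simp)
  have r5 := S.root _ _ _ _ _ _ x y ∅ tc tn hx hy0 (by simp) (by simp)
  have r6 := S.root _ _ _ _ _ _ x y ∅ tc ta hx hy0 (by simp) (by simp)
  have r7 := S.root _ _ _ _ _ _ x y ∅ ta tc hx hy0 (by simp) (by simp)
  -- Only b is excluded because a is free on top of it and the gain is positive. Only a is excluded
  -- because the root with cost A - 1 receives nothing. Both against none is decided by gain + rent,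
  -- the difference of their prices.
  by_cases hb : G.hB A β A x y ∅ = k <;> by_cases ha : G.hA A β A x y ∅ = k <;>
  simp only [pairLoad, b1, b2, n1, n2, m1, m2, ha, hb, hab.1, hab.2, hik, if_true, if_false,
      and_self, and_false, ne_eq, not_true_eq_false, not_false_eq_true, false_imp_iff,
      forall_true_left, true_and, and_true] at r1 r2 r3 r4 r5 r6 r7 ⊢ <;> linarith

/-- Another leaf does b for free, so the optimum is at most C + x and an additive root with costs (A
- 1, A - 1) receives nothing. It would prefer a alone, or the pair priced for β > 2 * A, if the
discounted root got either. -/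
lemma PairModel.Sound.coupled_of_nonempty (S : G.Sound k i ε E c C h)
    (P : Scales ε E c C x₀ κ A Y Y' h) {β x y : ℝ} (hAβ : A ≤ ε * β)
    (hAβ2 : 2 * A < β) (hx : 0 ≤ x) (hx' : x ≤ x₀) (hy : 0 ≤ y) {σ : Finset (Fin n)}
    (hσ : σ.Nonempty) (hk : k ∉ σ) (hi : i ∉ σ) : G.hA A β A x y σ ≠ k := by
  have hc := P.hc; have hC := P.hC; have h0 := P.hx₀
  have hO0 : 0 ≤ c * (C + x₀ + 1) := by positivity
  have hO : c * (C + x) ≤ c * (C + x₀ + 1) :=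
    mul_le_mul_of_nonneg_left (by linarith) (by linarith)
  have hA0 : 0 ≤ A := by linarith [P.hA]
  have hA1 : 0 ≤ A - 1 := by linarith [P.hA]
  have tc : PairType ε E A β A := ⟨hA0, by linarith, Or.inr ⟨rfl, P.hE, hAβ⟩⟩
  have ta : PairType ε E (A - 1) (A - 1) 0 := PairType.additive hA1 hA1
  obtain ⟨p1, -, -, p4, -, -⟩ := S.approx (A - 1) (A - 1) x y σ (C + x) hA1 hA1 hx hy hk hi
    (Or.inr (Or.inr ⟨hσ, le_rfl⟩))
  have m1 : G.hA (A - 1) (A - 1) 0 x y σ ≠ k := fun e => by linarith [p1 e, P.hA]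
  have m2 : G.hB (A - 1) (A - 1) 0 x y σ ≠ k := fun e => by linarith [p4 e, P.hA]
  intro ha
  have r6 := S.root _ _ _ _ _ _ x y σ tc ta hx hy hk hi
  have r7 := S.root _ _ _ _ _ _ x y σ ta tc hx hy hk hi
  by_cases hb : G.hB A β A x y σ = k <;>
  simp only [pairLoad, m1, m2, ha, hb, if_true, if_false, and_self, and_false] at r6 r7 <;> linarith

end Model

/-- A discrete intermediate value theorem: upward steps are at most 2, so the first entry above a
level lands within the window. Downward jumps are harmless. -/
lemma exists_mem_window (f : ℕ → ℕ) (M N₀ K : ℕ) (h1 : f 1 ≤ N₀)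
    (hstep : ∀ j, 1 ≤ j → j < M → f (j + 1) ≤ f j + 2) (hM : 1 ≤ M) (hK : N₀ + 8 * K ≤ f M)
    (q : ℕ) (hq : 1 ≤ q) (hqK : q ≤ K) :
    ∃ j, 1 ≤ j ∧ j ≤ M ∧ N₀ + 8 * q ≤ f j ∧ f j ≤ N₀ + 8 * q + 1 := by
  classical
  have hex : ∃ j, 1 ≤ j ∧ N₀ + 8 * q ≤ f j := ⟨M, hM, by omega⟩
  obtain ⟨hj1, hj2⟩ := Nat.find_spec hex
  have hjM : Nat.find hex ≤ M := Nat.find_min' hex ⟨hM, by omega⟩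
  refine ⟨Nat.find hex, hj1, hjM, hj2, ?_⟩
  have hne : Nat.find hex ≠ 1 := fun e => by rw [e] at hj2; omega
  have hlt := Nat.find_min hex (m := Nat.find hex - 1) (by omega)
  have hs := hstep (Nat.find hex - 1) (by omega) (by omega)
  rw [Nat.sub_add_cancel hj1] at hs
  by_contra! hgt
  exact hlt ⟨by omega, by omega⟩

/-! ### The boundary of the region where the root takes both tasks -/

section Model

variable {n : ℕ} {G : PairModel n} {k i : Fin n} {ε E c C x₀ κ A Y Y' h : ℝ}

/-- Two changes of the bundle of the leaf of the same kind lie on a common line of slope `±1`. -/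
lemma PairModel.Sound.flip_line (S : G.Sound k i ε E c C h) {ta tb d : ℝ}
    (ht : PairType ε E ta tb d) {σ : Finset (Fin n)} (hk : k ∉ σ) (hi : i ∉ σ)
    {x y x' y' w : ℝ} (hx : 0 ≤ x) (hy : 0 ≤ y) (hx' : 0 ≤ x') (hy' : 0 ≤ y') (hw : 0 ≤ w)
    (hxx : x ≠ x')
    (h1 : G.hA ta tb d x y σ = i ↔ G.hA ta tb d x' y' σ = i)
    (h2 : G.hA ta tb d x (y + w) σ = i ↔ G.hA ta tb d x' (y' + w) σ = i)
    (h3 : G.hB ta tb d x y σ = i ↔ G.hB ta tb d x' y' σ = i)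
    (h4 : G.hB ta tb d x (y + w) σ = i ↔ G.hB ta tb d x' (y' + w) σ = i)
    (hf : ¬ (G.hA ta tb d x y σ = i ↔ G.hA ta tb d x (y + w) σ = i)) :
    |(x + y) - (x' + y')| ≤ w ∨ |(x - y) - (x' - y')| ≤ w := by
  have e1 := S.leaf ta tb d x y x' (y' + w) σ ht hx hy hx' (by linarith) hk hi
  have e2 := S.leaf ta tb d x (y + w) x' y' σ ht hx (by linarith) hx' hy' hk hi
  simp only [← h1, ← h2, ← h3, ← h4] at e1 e2
  by_cases a1 : G.hA ta tb d x y σ = i <;> by_cases a2 : G.hA ta tb d x (y + w) σ = i <;>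
    simp only [a1, a2, not_true_eq_false, iff_true, iff_false, not_false_eq_true, if_true,
      if_false] at hf e1 e2 <;>
  by_cases b1 : G.hB ta tb d x y σ = i <;> by_cases b2 : G.hB ta tb d x (y + w) σ = i <;>
    simp only [b1, b2, if_true, if_false] at e1 e2
  -- The change of b is zero, of the same sign as that of a, or of opposite sign: this gives x = x',
  -- a bound on x + y, or a bound on x - y.
  all_goals first
    | exact absurd (by linarith : x = x') hxx
    | (left; rw [abs_le]; constructor <;> linarith)
    | (right; rw [abs_le]; constructor <;> linarith)

/-- From y to y' the root acquires a for σ = ∅, and it never holds a for the other σ, so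
`exists_flip` applies. -/
lemma PairModel.Sound.exists_leaf_flip (S : G.Sound k i ε E c C h)
    (P : Scales ε E c C x₀ κ A Y Y' h) (hik : i ≠ k) {β x y y' : ℝ} (hAβ : A ≤ ε * β)
    (hAβ2 : 2 * A < β) (hx : 0 ≤ x) (hx' : x ≤ x₀) (hy : 0 ≤ y) (hy' : 0 ≤ y')
    (hgood : ∀ σ : Finset (Fin n), k ∉ σ → i ∉ σ → ∀ z, z ≠ k → z ≠ i → z ∉ σ →
      (G.hA A β A x y σ = z ↔ G.hA A β A x y (insert z σ) = z))
    (hgood' : ∀ σ : Finset (Fin n), k ∉ σ → i ∉ σ → ∀ z, z ≠ k → z ≠ i → z ∉ σ →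
      (G.hA A β A x y' σ = z ↔ G.hA A β A x y' (insert z σ) = z))
    (hV : G.hA A β A x y ∅ ≠ k) (hU : G.hA A β A x y' ∅ = k) :
    ∃ σ : Finset (Fin n), k ∉ σ ∧ i ∉ σ ∧
      ¬ (G.hA A β A x y σ = i ↔ G.hA A β A x y' σ = i) := by
  set O : Finset (Fin n) := (Finset.univ.erase i).erase k with hO
  have hOk : k ∉ O := Finset.notMem_erase _ _
  have hOi : i ∉ O := by simp [hO]
  have hmem : ∀ z, z ∈ O ↔ z ≠ k ∧ z ≠ i := by intro z; simp [hO]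
  obtain ⟨σ, hσ, hf⟩ := exists_flip O i k hik hOi hOk (fun z h1 h2 => (hmem z).2 ⟨h2, h1⟩)
    (fun σ => G.hA A β A x y σ) (fun σ => G.hA A β A x y' σ)
    (fun σ hσ z hz hzσ => hgood σ (fun e => hOk (hσ e)) (fun e => hOi (hσ e)) z ((hmem z).1 hz).1
      ((hmem z).1 hz).2 hzσ)
    (fun σ hσ z hz hzσ => hgood' σ (fun e => hOk (hσ e)) (fun e => hOi (hσ e)) z ((hmem z).1 hz).1
      ((hmem z).1 hz).2 hzσ)
    (fun σ hσ => by
      rcases Finset.eq_empty_or_nonempty σ with rfl | hne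
      · exact hV
      · exact S.coupled_of_nonempty P hAβ hAβ2 hx hx' hy hne (fun e => hOk (hσ e))
          (fun e => hOi (hσ e)))
    (fun σ hσ hne => S.coupled_of_nonempty P hAβ hAβ2 hx hx' hy' hne (fun e => hOk (hσ e))
          (fun e => hOi (hσ e)))
    hU
  exact ⟨σ, fun e => hOk (hσ e), fun e => hOi (hσ e), hf⟩

/-- On average the rent grows at least as fast as `1 / c`. -/
lemma PairModel.Sound.exists_steep_block (S : G.Sound k i ε E c C h)
    (P : Scales ε E c C x₀ κ A Y Y' h) (hik : i ≠ k) {w Γ s : ℝ} {d Q : ℕ} (hw : 0 < w)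
    (hwx : w ≤ x₀) (hd : c * (Γ + 2 * s) ≤ d * w) (hΓ : 0 ≤ Γ) (hs : 0 ≤ s)
    (hY' : Y + (Q * d + 2) * w ≤ Y') (hQ1 : 1 ≤ Q)
    (hQ : c * (C + x₀ + Y + d * w) + 3 + C + x₀ ≤ Q * s) :
    ∃ q : ℕ, 1 ≤ q ∧ q < Q ∧ G.rent κ h w (Y + (q * d : ℕ) * w) + (Γ + s) ≤
      G.rent κ h w (Y + ((q + 1) * d : ℕ) * w) := by
  have hc := P.hc; have hC := P.hC; have h0 := P.hx₀; have hY0 := P.nonneg_Y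
  have hc0 : 0 < c := by linarith
  have hle : ∀ q : ℕ, q ≤ Q → Y + (q * d : ℕ) * w ≤ Y' := by
    intro q hq
    have : ((q * d : ℕ) : ℝ) ≤ Q * d := by push_cast; gcongr
    nlinarith
  have hge : ∀ q : ℕ, Y ≤ Y + (q * d : ℕ) * w := fun q => by
    have : 0 ≤ ((q * d : ℕ) : ℝ) * w := by positivity
    linarith
  -- Otherwise each block adds less than Γ + s, while the lower bound of order y / c gains Γ + 2 * s
  -- per block; Q * s outweighs the additive constants.
  by_contra! hcon
  have htel : ∀ q : ℕ, 1 ≤ q → q ≤ Q → G.rent κ h w (Y + (q * d : ℕ) * w) ≤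
      G.rent κ h w (Y + (1 * d : ℕ) * w) + (q - 1 : ℝ) * (Γ + s) := by
    intro q hq
    induction q, hq using Nat.le_induction with
    | base => intro _; simp
    | succ q hq ih =>
      intro hqQ
      have h1 := ih (by omega)
      have h2 := hcon q hq (by omega)
      push_cast at h1 h2 ⊢
      linarith
  have h1 := htel Q hQ1 le_rfl
  have h2 := S.rent_le P hik hw.le hwx (hge 1) (hle 1 hQ1)
  -- Chosen so that c * (C + x₀ + β) is the cost y at the end of the last block, minus c.
  set β : ℝ := (Y + (Q * d : ℕ) * w) / c - C - x₀ - 1 with hβ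
  have hdw : ((Q * d : ℕ) : ℝ) * w / c ≥ Q * (Γ + 2 * s) := by
    rw [ge_iff_le, le_div_iff₀ hc0]
    push_cast
    have : (0 : ℝ) ≤ Q := by positivity
    nlinarith
  have hYc : 0 ≤ Y / c := by positivity
  have hdw0 : (0 : ℝ) ≤ d * w := by positivity
  have hcx : 0 ≤ c * (C + x₀ + Y + d * w) := by positivity
  have hsplit : (Y + (Q * d : ℕ) * w) / c = Y / c + ((Q * d : ℕ) : ℝ) * w / c := by ring
  have hQΓ : 0 ≤ (Q : ℝ) * Γ := by positivity
  have hβ0 : 0 ≤ β := by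
    rw [hβ, hsplit]
    nlinarith
  have h3 := S.le_rent P hik hβ0 hw.le hwx (hge Q) (hle Q le_rfl) (by
    have e : c * (C + x₀ + β) = (Y + (Q * d : ℕ) * w) - c := by
      rw [hβ]; field_simp; ring
    rw [e]; linarith)
  have e1 : ((1 * d : ℕ) : ℝ) * w = d * w := by push_cast; ring
  rw [e1] at h1 h2
  rw [hβ, hsplit] at h3
  have e2 : c * (C + x₀ + (Y + d * w)) = c * (C + x₀ + Y + d * w) := by ring
  rw [e2] at h2
  nlinarith

/-- The root keeps a task of cost `γ ≤ Γ` whenever the leaf has cost `x₀`, provided that no other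
leaf changes its mind about `a` when `b` becomes free to it. -/
theorem PairModel.Sound.root_keeps (S : G.Sound k i ε E c C h)
    (P : Scales ε E c C x₀ κ A Y Y' h) (hik : i ≠ k) {w Γ γ s b : ℝ} {M d Q : ℕ} {T : Finset ℝ}
    (hw : 0 < w) (hMx : M * w < x₀) (hMd : d + 2 + 8 * (2 ^ n * 16 + 1) ≤ M)
    (hd1 : 1 ≤ d) (hd : c * (Γ + 2 * s) ≤ d * w) (hγ : 0 ≤ γ) (hγΓ : γ ≤ Γ) (hs : 0 < s)
    (hY' : Y + (Q * d + 2) * w ≤ Y') (hQ1 : 1 ≤ Q)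
    (hQ : c * (C + x₀ + Y + d * w) + 3 + C + x₀ ≤ Q * s)
    (hb0 : 0 ≤ b) (hb : c * (C + x₀ + b) < Y) (hAb : A ≤ ε * b) (hAb2 : 2 * A < b) (hε : 0 ≤ ε)
    (hT : ∀ l, b ≤ l → l ≤ c * (C + x₀ + Y') + 1 + Γ → ∀ V : Finset ℝ,
      V.card ≤ M * (Q * d + 3) → ∃ β ∈ T, l < β ∧ β < l + s ∧ β ∉ V)
    (hab : ∀ j l : ℕ, 1 ≤ j → j ≤ M → l ≤ Q * d + 2 →
      G.hA κ κ 0 (j * w) (Y + l * w) ∅ = k ∧ G.hB κ κ 0 (j * w) (Y + l * w) ∅ = k)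
    (hab₀ : G.hA κ κ 0 x₀ Y ∅ = k ∧ G.hB κ κ 0 x₀ Y ∅ = k)
    (hgood : ∀ β ∈ T, ∀ j l : ℕ, 1 ≤ j → j ≤ M → l ≤ Q * d + 2 → ∀ σ : Finset (Fin n), k ∉ σ →
      i ∉ σ → ∀ z, z ≠ k → z ≠ i → z ∉ σ →
      (G.hA A β A (j * w) (Y + l * w) σ = z ↔ G.hA A β A (j * w) (Y + l * w) (insert z σ) = z)) :
    G.hA γ κ 0 x₀ Y ∅ = k := by
  by_contra hrefuse
  have hΓ : 0 ≤ Γ := hγ.trans hγΓ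
  have hY0 := P.nonneg_Y
  have hM1 : 1 ≤ M := by omega
  have hx0 : ∀ j : ℕ, 0 ≤ (j : ℝ) * w := fun j => by positivity
  have hxM : ∀ j : ℕ, j ≤ M → (j : ℝ) * w < x₀ := fun j hj => by
    have : (j : ℝ) ≤ M := by exact_mod_cast hj
    nlinarith
  have hyY : ∀ l : ℕ, Y ≤ Y + l * w := fun l => by
    have := hx0 l
    linarith
  have hyY' : ∀ l : ℕ, l ≤ Q * d + 2 → Y + l * w ≤ Y' := fun l hl => by
    have : (l : ℝ) ≤ Q * d + 2 := by exact_mod_cast hl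
    nlinarith
  have hwx : w ≤ x₀ := by have := hxM 1 hM1; rw [Nat.cast_one, one_mul] at this; exact this.le
  have hg0 : G.gain κ h x₀ Y ≤ γ :=
    (S.gain_of_light P hik hγ P.hx₀ le_rfl le_rfl P.hYY hab₀).2 hrefuse
  -- The refusal bounds the gain at (x₀, Y) by γ. All grid values of x lie below x₀, and
  -- monotonicity of the gain ignores y.
  have hgle : ∀ j l : ℕ, 1 ≤ j → j ≤ M → l ≤ Q * d + 2 →
      G.gain κ h (j * w) (Y + l * w) ≤ Γ := fun j l h1 h2 h3 =>
    ((S.gain_mono P hik (hx0 j) (hxM j h2) le_rfl (hyY l) (hyY' l h3) le_rfl P.hYY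
      (hab j l h1 h2 h3) hab₀).trans hg0).trans hγΓ
  have hgpos : ∀ j l : ℕ, 1 ≤ j → j ≤ M → l ≤ Q * d + 2 →
      0 < G.gain κ h (j * w) (Y + l * w) := fun j l h1 h2 h3 =>
    lt_of_lt_of_le P.hκ (S.le_gain P hik (hx0 j) (hxM j h2).le (hyY l) (hyY' l h3)
      (hab j l h1 h2 h3))
  obtain ⟨q, hq1, hqQ, hq⟩ := S.exists_steep_block P hik hw hwx hd hΓ hs.le hY' hQ1 hQ
  have hqd : (q + 1) * d ≤ Q * d := Nat.mul_le_mul_right d hqQ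
  have hqd' : (q + 1) * d = q * d + d := by ring
  have hqd1 : 1 ≤ q * d := Nat.one_le_iff_ne_zero.2 (Nat.mul_ne_zero (by omega) (by omega))
  set r₀ := G.rent κ h w (Y + (q * d : ℕ) * w) with hr₀
  have hbr : b ≤ r₀ := S.le_rent P hik hb0 hw.le hwx (hyY _) (hyY' _ (by omega))
    (lt_of_lt_of_le hb (hyY _))
  have hrY : r₀ ≤ c * (C + x₀ + Y') + 1 := by
    refine (S.rent_le P hik hw.le hwx (hyY _) (hyY' _ (by omega))).trans ?_
    have := hyY' (q * d) (by omega)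
    have hc := P.hc
    gcongr
  set Φ : ℕ → ℕ → ℝ := fun j l =>
    G.gain κ h (j * w) (Y + l * w) + G.rent κ h (j * w) (Y + l * w) with hΦ
  set V : Finset ℝ := (Finset.Icc 1 M ×ˢ Finset.range (Q * d + 3)).image (fun p => Φ p.1 p.2)
    with hV
  -- The steep block leaves room of length s above r₀ + Γ. Avoiding the values in V turns the weak
  -- inequalities of `coupled` into a dichotomy.
  obtain ⟨β, hβT, hβ1, hβ2, hβV⟩ := hT (r₀ + Γ) (by linarith) (by linarith) V (by
    refine Finset.card_image_le.trans ?_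
    simp)
  have hβb : b ≤ β := by linarith
  have hAβ : A ≤ ε * β := hAb.trans (by gcongr)
  have hAβ2 : 2 * A < β := by linarith
  have hne : ∀ j l : ℕ, 1 ≤ j → j ≤ M → l ≤ Q * d + 2 → Φ j l ≠ β := by
    intro j l h1 h2 h3 e
    refine hβV (Finset.mem_image.2 ⟨(j, l), ?_, e⟩)
    simp only [Finset.mem_product, Finset.mem_Icc, Finset.mem_range]
    omega
  have hlow : ∀ j l : ℕ, 1 ≤ j → j ≤ M → l < q * d → Φ j l < β := by
    intro j l h1 h2 h3
    have e1 := hgle j l h1 h2 (by omega)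
    have e2 := S.rent_mono P hik (hx0 j) (hxM j h2).le hw.le hwx (hyY l)
      (y' := Y + (q * d : ℕ) * w) (by gcongr) (hyY' _ (by omega))
    simp only [hΦ]; linarith
  -- The extra grid step is there because `rent_mono` needs a strictly larger y.
  have hhigh : ∀ j : ℕ, 1 ≤ j → j ≤ M → β < Φ j ((q + 1) * d + 1) := by
    intro j h1 h2
    have e1 := hgpos j ((q + 1) * d + 1) h1 h2 (by omega)
    have e2 := S.rent_mono P hik hw.le hwx (hx0 j) (hxM j h2).le (hyY _)
      (y := Y + ((q + 1) * d : ℕ) * w) (y' := Y + ((q + 1) * d + 1 : ℕ) * w)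
      (by gcongr; exact Nat.lt_succ_self _) (hyY' _ (by omega))
    simp only [hΦ]; linarith
  have hmono : ∀ j l j' l' : ℕ, 1 ≤ j → j < j' → j' ≤ M → l < l' → l' ≤ Q * d + 2 →
      Φ j l ≤ Φ j' l' := by
    intro j l j' l' h1 h2 h3 h4 h5
    exact add_le_add
      (S.gain_mono P hik (hx0 j) (by gcongr) (hxM j' h3).le (hyY l) (hyY' l (by omega)) (hyY l')
        (hyY' l' h5) (hab j l h1 (by omega) (by omega)) (hab j' l' (by omega) h3 h5))
      (S.rent_mono P hik (hx0 j) (hxM j (by omega)).le (hx0 j') (hxM j' h3).le (hyY l)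
        (by gcongr) (hyY' l' h5))
  have hfirst : ∀ j : ℕ, ∃ l : ℕ, 1 ≤ j → j ≤ M →
      q * d ≤ l ∧ l ≤ (q + 1) * d + 1 ∧ β < Φ j l ∧ ∀ l' < l, ¬ β < Φ j l' := by
    classical
    intro j
    by_cases hj : 1 ≤ j ∧ j ≤ M
    · have hex : ∃ l, β < Φ j l := ⟨_, hhigh j hj.1 hj.2⟩
      refine ⟨Nat.find hex, fun _ _ => ⟨?_, Nat.find_min' hex (hhigh j hj.1 hj.2),
        Nat.find_spec hex, fun l' hl' => Nat.find_min hex hl'⟩⟩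
      by_contra! hlt
      exact lt_asymm (Nat.find_spec hex) (hlow j _ hj.1 hj.2 hlt)
    · exact ⟨0, fun h1 h2 => absurd ⟨h1, h2⟩ hj⟩
  choose N hN using hfirst
  -- N j is the height of the boundary over column j. Only points with both coordinates strictly
  -- ordered are comparable, hence the slack of 1.
  have hNmono : ∀ j j' : ℕ, 1 ≤ j → j < j' → j' ≤ M → N j' ≤ N j + 1 := by
    intro j j' h1 h2 h3
    obtain ⟨p1, p2, p3, p4⟩ := hN j h1 (by omega)
    obtain ⟨s1, s2, s3, s4⟩ := hN j' (by omega) h3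
    by_contra! hlt
    exact s4 (N j + 1) hlt (lt_of_lt_of_le p3 (hmono j _ j' _ h1 h2 h3 (Nat.lt_succ_self _)
      (by omega)))
  set K := 2 ^ n * 16 + 1 with hK
  -- All N j lie in a strip of height d + 1 and M exceeds d by enough, so j + N j passes through K
  -- windows; its values in distinct windows differ by at least 7.
  have hwin := exists_mem_window (fun j => j + N j) M ((q + 1) * d + 2) K
    (by have := (hN 1 le_rfl hM1).2.1; omega)
    (fun j h1 h2 => by
      have := hNmono j (j + 1) h1 (Nat.lt_succ_self j) (by omega)
      omega) hM1
    (by have := (hN M hM1 le_rfl).1; omega)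
  have hpts : ∀ p : Fin K, ∃ j, 1 ≤ j ∧ j ≤ M ∧
      (q + 1) * d + 2 + 8 * (p.1 + 1) ≤ j + N j ∧
      j + N j ≤ (q + 1) * d + 2 + 8 * (p.1 + 1) + 1 :=
    fun p => hwin (p.1 + 1) (by omega) (by have := p.2; omega)
  choose J hJ1 hJM hJlo hJhi using hpts
  have hprev : ∀ j : ℕ, 1 ≤ j → j ≤ M → Y + (N j : ℝ) * w = Y + ((N j - 1 : ℕ) : ℝ) * w + w := by
    intro j h1 h2
    have := (hN j h1 h2).1
    rw [Nat.cast_sub (by omega)]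
    push_cast; ring
  have hflip : ∀ p : Fin K, ∃ σ : Finset (Fin n), k ∉ σ ∧ i ∉ σ ∧
      ¬ (G.hA A β A (J p * w) (Y + ((N (J p) - 1 : ℕ) : ℝ) * w) σ = i ↔
        G.hA A β A (J p * w) (Y + ((N (J p) - 1 : ℕ) : ℝ) * w + w) σ = i) := by
    intro p
    have h1 := hJ1 p
    have h2 := hJM p
    obtain ⟨p1, p2, p3, p4⟩ := hN (J p) h1 h2
    have l1 : N (J p) - 1 ≤ Q * d + 2 := by omega
    have l2 : N (J p) ≤ Q * d + 2 := by omega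
    rw [← hprev (J p) h1 h2]
    refine S.exists_leaf_flip P hik hAβ hAβ2 (hx0 _) (hxM _ h2).le (hY0.trans (hyY _))
      (hY0.trans (hyY _)) (hgood β hβT _ _ h1 h2 l1) (hgood β hβT _ _ h1 h2 l2) ?_ ?_
    · intro hk
      have e1 := (S.coupled P hik (hb0.trans hβb) hAβ (hx0 _) (hxM _ h2).le (hyY _) (hyY' _ l1)
        (hab _ _ h1 h2 l1)).1 hk
      exact p4 (N (J p) - 1) (by omega) (lt_of_le_of_ne e1 (hne _ _ h1 h2 l1).symm)
    · by_contra hk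
      have e1 := (S.coupled P hik (hb0.trans hβb) hAβ (hx0 _) (hxM _ h2).le (hyY _) (hyY' _ l2)
        (hab _ _ h1 h2 l2)).2 hk
      exact absurd p3 (not_lt.2 e1)
  choose σ hσk hσi hσ using hflip
  -- The kind of a change: the set σ and what leaf i holds before and after. There are 2 ^ n * 16
  -- kinds, one fewer than K.
  let cls : Fin K → Finset (Fin n) × Bool × Bool × Bool × Bool := fun p =>
    (σ p, decide (G.hA A β A (J p * w) (Y + ((N (J p) - 1 : ℕ) : ℝ) * w) (σ p) = i),
      decide (G.hA A β A (J p * w) (Y + ((N (J p) - 1 : ℕ) : ℝ) * w + w) (σ p) = i),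
      decide (G.hB A β A (J p * w) (Y + ((N (J p) - 1 : ℕ) : ℝ) * w) (σ p) = i),
      decide (G.hB A β A (J p * w) (Y + ((N (J p) - 1 : ℕ) : ℝ) * w + w) (σ p) = i))
  obtain ⟨p, p', hpp, heq⟩ := Fintype.exists_ne_map_eq_of_card_lt cls (by
    simp only [Fintype.card_prod, Fintype.card_finset, Fintype.card_bool, Fintype.card_fin, hK]
    omega)
  simp only [cls, Prod.mk.injEq, decide_eq_decide] at heq
  obtain ⟨q0, q1, q2, q3, q4⟩ := heq
  rw [← q0] at q1 q2 q3 q4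
  have hpp' : (p : ℕ) ≠ p' := fun e => hpp (Fin.ext e)
  have a1 := hJ1 p; have a2 := hJM p; have a3 := hJlo p; have a4 := hJhi p
  have b1 := hJ1 p'; have b2 := hJM p'; have b3 := hJlo p'; have b4 := hJhi p'
  have hJJ : J p ≠ J p' := fun e => by rw [e] at a3 a4; omega
  have hNa := (hN (J p) a1 a2).1
  have hNb := (hN (J p') b1 b2).1
  have tc : PairType ε E A β A := by
    have hc := P.hc; have hC := P.hC; have h0 := P.hx₀
    have : 0 ≤ c * (C + x₀ + 1) := by positivity
    exact ⟨by linarith [P.hA], by linarith, Or.inr ⟨rfl, P.hE, hAβ⟩⟩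
  have hline := S.flip_line tc (hσk p) (hσi p) (hx0 (J p)) (hY0.trans (hyY (N (J p) - 1)))
    (hx0 (J p')) (hY0.trans (hyY (N (J p') - 1))) hw.le
    (fun e => hJJ (by exact_mod_cast mul_right_cancel₀ hw.ne' e)) q1 q2 q3 q4 (hσ p)
  have hcast : ((N (J p) - 1 : ℕ) : ℝ) = ((N (J p) : ℤ) : ℝ) - 1 := by
    rw [Nat.cast_sub (by omega)]; simp
  have hcast' : ((N (J p') - 1 : ℕ) : ℝ) = ((N (J p') : ℤ) : ℝ) - 1 := by
    rw [Nat.cast_sub (by omega)]; simp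
  have hint : |((J p : ℤ) + N (J p)) - (J p' + N (J p'))| ≤ 1 ∨
      |((J p : ℤ) - N (J p)) - (J p' - N (J p'))| ≤ 1 := by
    rw [hcast, hcast'] at hline
    refine hline.imp (fun h => ?_) (fun h => ?_)
    · have e : ((J p : ℝ) * w + (Y + (((N (J p) : ℤ) : ℝ) - 1) * w)) -
          ((J p' : ℝ) * w + (Y + (((N (J p') : ℤ) : ℝ) - 1) * w)) =
          ((((J p : ℤ) + N (J p)) - (J p' + N (J p')) : ℤ) : ℝ) * w := by push_cast; ring
      rw [e, abs_mul, abs_of_pos hw] at h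
      have h' := le_of_mul_le_mul_right (h.trans_eq (one_mul w).symm) hw
      exact_mod_cast h'
    · have e : ((J p : ℝ) * w - (Y + (((N (J p) : ℤ) : ℝ) - 1) * w)) -
          ((J p' : ℝ) * w - (Y + (((N (J p') : ℤ) : ℝ) - 1) * w)) =
          ((((J p : ℤ) - N (J p)) - (J p' - N (J p')) : ℤ) : ℝ) * w := by push_cast; ring
      rw [e, abs_mul, abs_of_pos hw] at h
      have h' := le_of_mul_le_mul_right (h.trans_eq (one_mul w).symm) hw
      exact_mod_cast h'
  -- Slope -1 contradicts the separation of the windows. Slope 1, where N rises by at most 1, would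
  -- put the columns within 2 and the sums within 3 of each other.
  rw [abs_le, abs_le] at hint
  rcases lt_or_gt_of_ne hJJ with hlt | hlt
  · have := hNmono _ _ a1 hlt b2
    omega
  · have := hNmono _ _ b1 hlt a2
    omega

end Model

/-! ### Scales, and a finite set of test values for β -/

/-- The constants of the construction. -/
structure Grid (n : ℕ) (ε c C Γ x₀ : ℝ) where
  (w s b A Y Y' h : ℝ)
  (M d Q : ℕ)
  T : Finset ℝ
  hw : 0 < w
  hMx : M * w < x₀
  hMd : d + 2 + 8 * (2 ^ n * 16 + 1) ≤ M
  hd1 : 1 ≤ d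
  hd : c * (Γ + 2 * s) ≤ d * w
  hs : 0 < s
  hY' : Y + (Q * d + 2) * w ≤ Y'
  hQ1 : 1 ≤ Q
  hQ : c * (C + x₀ + Y + d * w) + 3 + C + x₀ ≤ Q * s
  hb0 : 0 ≤ b
  hb : c * (C + x₀ + b) < Y
  hAb : A ≤ ε * b
  hAb2 : 2 * A < b
  hT : ∀ l, b ≤ l → l ≤ c * (C + x₀ + Y') + 1 + Γ → ∀ V : Finset ℝ,
      V.card ≤ M * (Q * d + 3) → ∃ β ∈ T, l < β ∧ β < l + s ∧ β ∉ V
  hTb : ∀ β ∈ T, b ≤ β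
  hA : c * (C + x₀ + 1) + 1 < A
  hY : c * (C + x₀ + 1) < Y
  hh : c * (C + x₀ + 1 + Y') < h
  hYY : Y ≤ Y'

/-- A finite set that is dense enough to contain, in every interval of length `s`, an element that
avoids a given set of `N` numbers. -/
lemma exists_finset_avoiding (s B : ℝ) (N : ℕ) (hs : 0 < s) :
    ∃ T : Finset ℝ, ∀ l, 0 ≤ l → l ≤ B → ∀ V : Finset ℝ, V.card ≤ N →
      ∃ β ∈ T, l < β ∧ β < l + s ∧ β ∉ V := by
  classical
  -- An open interval of length s then contains N + 1 consecutive multiples of z, one more than can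
  -- be excluded.
  set z : ℝ := s / (N + 2) with hz
  have hz0 : 0 < z := by positivity
  refine ⟨(Finset.range (⌈(B + s) / z⌉₊ + 1)).image fun e : ℕ => z * e, ?_⟩
  intro l hl hlB V hV
  set e₀ : ℕ := ⌊l / z⌋₊ + 1 with he₀
  have h1 : l < z * e₀ := by
    have := Nat.lt_floor_add_one (l / z)
    rw [div_lt_iff₀ hz0] at this
    rw [he₀]; push_cast; linarith
  have h2 : z * e₀ ≤ l + z := by
    have := Nat.floor_le (div_nonneg hl hz0.le)
    rw [le_div_iff₀ hz0] at this
    rw [he₀]; push_cast; linarith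
  have hinj : Function.Injective fun e : ℕ => z * ((e₀ + e : ℕ) : ℝ) := by
    intro p q hpq
    have := mul_left_cancel₀ hz0.ne' hpq
    exact Nat.add_left_cancel (by exact_mod_cast this)
  obtain ⟨β, hβ, hβV⟩ := Finset.exists_mem_notMem_of_card_lt_card (s := V)
    (t := (Finset.range (N + 1)).image fun e : ℕ => z * ((e₀ + e : ℕ) : ℝ))
    (by rw [Finset.card_image_of_injective _ hinj, Finset.card_range]; omega)
  obtain ⟨e, he, rfl⟩ := Finset.mem_image.1 hβ
  rw [Finset.mem_range] at he
  have heN : (e : ℝ) ≤ N := by exact_mod_cast Nat.lt_succ_iff.1 he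
  have hzs : z * (N + 2) = s := by rw [hz]; field_simp
  have h3 : z * ((e₀ + e : ℕ) : ℝ) < l + s := by push_cast; nlinarith
  have he0 : (0 : ℝ) ≤ e := by positivity
  refine ⟨_, Finset.mem_image.2 ⟨e₀ + e, ?_, rfl⟩, by push_cast; nlinarith, h3, hβV⟩
  rw [Finset.mem_range, Nat.lt_succ_iff]
  have h4 : ((e₀ + e : ℕ) : ℝ) ≤ (B + s) / z := by
    rw [le_div_iff₀ hz0]; linarith
  exact_mod_cast h4.trans (Nat.le_ceil _)

lemma exists_grid (n : ℕ) {ε c C Γ x₀ : ℝ} (hε : 0 < ε) (hc : 1 ≤ c) (hC : 0 ≤ C) (hΓ : 0 ≤ Γ)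
    (hx : c * Γ < x₀) : Nonempty (Grid n ε c C Γ x₀) := by
  have hx0 : 0 < x₀ := lt_of_le_of_lt (by positivity) hx
  set L : ℕ := 8 * (2 ^ n * 16 + 1) with hL
  -- Since d exceeds c * Γ / w by less than 2, the M = d + 2 + L columns still fit below x₀.
  set w : ℝ := (x₀ - c * Γ) / (L + 6) with hwdef
  have hw : 0 < w := div_pos (by linarith) (by positivity)
  have hwL : w * (L + 6) = x₀ - c * Γ := by rw [hwdef]; field_simp
  set s : ℝ := w / (2 * c) with hsdef
  have hc0 : 0 < c := by linarith
  have hs : 0 < s := by positivity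
  have hcs : c * (2 * s) = w := by rw [hsdef]; field_simp
  set d : ℕ := ⌈c * Γ / w⌉₊ + 1 with hddef
  have hd : c * (Γ + 2 * s) ≤ d * w := by
    have := Nat.le_ceil (c * Γ / w)
    rw [div_le_iff₀ hw] at this
    rw [hddef]; push_cast; linarith
  have hd' : d * w < c * Γ + 2 * w := by
    have := Nat.ceil_lt_add_one (a := c * Γ / w) (by positivity)
    rw [← sub_lt_iff_lt_add, lt_div_iff₀ hw] at this
    rw [hddef]; push_cast; linarith
  set M : ℕ := d + 2 + L with hMdef
  -- A - 1 must break the ratio as well: the discounted root is compared with additive ones of cost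
  -- A - 1.
  set A : ℝ := c * (C + x₀ + 1) + 2 with hAdef
  have hO : 0 ≤ c * (C + x₀ + 1) := by positivity
  set b : ℝ := 2 * A + 1 + A / ε with hbdef
  have hA0 : 0 < A := by linarith
  have hAε : 0 < A / ε := by positivity
  set Y : ℝ := c * (C + x₀ + b) + 1 with hYdef
  obtain ⟨Q, hQ⟩ := exists_nat_ge ((c * (C + x₀ + Y + d * w) + 3 + C + x₀) / s + 1)
  have hY1 : c * (C + x₀ + 1) ≤ c * (C + x₀ + b) := by
    apply mul_le_mul_of_nonneg_left _ hc0.le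
    linarith
  have hYpos : 0 < Y := by linarith
  have hfrac : 0 ≤ (c * (C + x₀ + Y + d * w) + 3 + C + x₀) / s := by positivity
  set Y' : ℝ := Y + (Q * d + 2) * w with hY'def
  obtain ⟨T, hT⟩ := exists_finset_avoiding s (c * (C + x₀ + Y') + 1 + Γ) (M * (Q * d + 3)) hs
  refine ⟨⟨w, s, b, A, Y, Y', c * (C + x₀ + 1 + Y') + 1, M, d, Q,
    T.filter (b ≤ ·), hw, ?_, ?_, ?_, hd, hs, le_rfl, ?_, ?_, ?_, ?_, ?_, ?_, ?_, ?_, ?_, ?_, ?_,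
    ?_⟩⟩
  · rw [hMdef]; push_cast; nlinarith
  · omega
  · omega
  · have : (1 : ℝ) ≤ Q := by linarith
    exact_mod_cast this
  · have : (c * (C + x₀ + Y + d * w) + 3 + C + x₀) / s ≤ Q := by linarith
    rwa [div_le_iff₀ hs] at this
  · linarith
  · linarith
  · have : ε * (A / ε) = A := by field_simp
    have h2 : 0 ≤ ε * (2 * A + 1) := by positivity
    rw [hbdef, mul_add, this]; linarith
  · linarith
  · intro l hl hlB V hV
    obtain ⟨β, hβT, hβ⟩ := hT l (by linarith) hlB V hV
    exact ⟨β, Finset.mem_filter.2 ⟨hβT, hl.trans hβ.1.le⟩, hβ⟩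
  · exact fun β hβ => (Finset.mem_filter.1 hβ).2
  · linarith
  · linarith
  · linarith
  · have : 0 ≤ ((Q : ℝ) * d + 2) * w := by positivity
    linarith

/-! ### Avoiding exceptional values -/

/-- A counting argument: if each of fewer than `K` events rules out, along one coordinate, at most
one of `K` values, then all the events can be avoided at once. -/
lemma exists_avoiding {V Ev : Type*} [Fintype V] [DecidableEq V] [Fintype Ev] (K : ℕ)
    (hK : Fintype.card Ev < K) (v : Ev → V) (bad : Ev → (V → Fin K) → Prop)
    (hbad : ∀ e X X', (∀ u, u ≠ v e → X u = X' u) → bad e X → bad e X' → X = X') :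
    ∃ X, ∀ e, ¬ bad e X := by
  classical
  by_contra! hcon
  set B : Ev → Finset (V → Fin K) := fun e => Finset.univ.filter (bad e) with hB
  -- Overwriting the coordinate `v e` maps the bad assignments times `Fin K` injectively into all
  -- assignments, so each event excludes at most a share 1 / K.
  have hBcard : ∀ e, (B e).card * K ≤ Fintype.card (V → Fin K) := by
    intro e
    have : (B e ×ˢ (Finset.univ : Finset (Fin K))).card ≤
        (Finset.univ : Finset (V → Fin K)).card := by
      refine Finset.card_le_card_of_injOn (fun p => Function.update p.1 (v e) p.2)
        (fun _ _ => Finset.mem_coe.2 (Finset.mem_univ _)) ?_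
      rintro ⟨X, q⟩ hX ⟨X', q'⟩ hX' heq
      simp only [hB, Finset.coe_product, Set.mem_prod, Finset.mem_coe, Finset.mem_filter,
        Finset.mem_univ, true_and, and_true] at hX hX'
      simp only at heq
      have hq : q = q' := by
        have := congrFun heq (v e)
        simpa using this
      have hXX : X = X' := by
        refine hbad e X X' (fun u hu => ?_) hX hX'
        have := congrFun heq u
        simpa [Function.update_of_ne hu] using this
      rw [hq, hXX]
    rwa [Finset.card_product, Finset.card_univ, Finset.card_univ, Fintype.card_fin] at this
  have hcover : (Finset.univ : Finset (V → Fin K)) ⊆ Finset.univ.biUnion B := by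
    intro X _
    obtain ⟨e, he⟩ := hcon X
    exact Finset.mem_biUnion.2 ⟨e, Finset.mem_univ _, by simp [hB, he]⟩
  have h1 : Fintype.card (V → Fin K) ≤ ∑ e, (B e).card :=
    (Finset.card_le_card hcover).trans Finset.card_biUnion_le
  have h2 : (∑ e, (B e).card) * K ≤ Fintype.card Ev * Fintype.card (V → Fin K) := by
    rw [Finset.sum_mul]
    refine (Finset.sum_le_sum fun e _ => hBcard e).trans ?_
    simp
  have hpos : 0 < Fintype.card (V → Fin K) :=
    Fintype.card_pos_iff.2 ⟨fun _ => ⟨0, by omega⟩⟩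
  have h3 := Nat.mul_le_mul_right K h1
  have h4 : Fintype.card (V → Fin K) * K ≤ Fintype.card (V → Fin K) * Fintype.card Ev := by
    rw [Nat.mul_comm _ (Fintype.card Ev)]
    exact h3.trans h2
  exact absurd (Nat.le_of_mul_le_mul_left h4 hpos) (by omega)

/-! ### Discounted costs, weak monotonicity and approximation -/

variable {n m : ℕ}

/-- Additive costs, and additive costs with a discount on one pair `a`, `b`: the task `a`, which is
much cheaper than `b`, is free for a machine that also processes `b`. -/
def nearAdditive (m : ℕ) (ε E : ℝ) : Set (Cost m) :=
  {v | IsAdditive v ∨ ∃ (w : Fin m → ℝ) (a b : Fin m), a ≠ b ∧ (∀ t, 0 ≤ w t) ∧ w a ≤ E ∧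
    w a ≤ ε * w b ∧ v = fun S => ∑ t ∈ S, w t - if a ∈ S ∧ b ∈ S then w a else 0}

lemma isAdditive_sum (w : Fin m → ℝ) (hw : ∀ t, 0 ≤ w t) :
    IsAdditive (fun S : Finset (Fin m) => ∑ t ∈ S, w t) :=
  ⟨⟨by simp, fun _ _ hST => Finset.sum_le_sum_of_subset_of_nonneg hST fun t _ _ => hw t⟩,
    fun S => by simp⟩

/-- The payments cancel when the two incentive constraints are added. -/
lemma Mechanism.TruthfulOn.wmon {M : Mechanism n m} {D : Fin n → Set (Cost m)}
    (hT : M.TruthfulOn D) {P P' : Profile n m} (hP : ∀ j, P j ∈ D j) (hP' : ∀ j, P' j ∈ D j)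
    (ℓ : Fin n) (hag : ∀ j, j ≠ ℓ → P j = P' j) :
    P ℓ ((M.alloc P).bundle ℓ) + P' ℓ ((M.alloc P').bundle ℓ) ≤
      P ℓ ((M.alloc P').bundle ℓ) + P' ℓ ((M.alloc P).bundle ℓ) := by
  have e : Function.update P ℓ (P' ℓ) = P' := by
    funext j
    by_cases h : j = ℓ
    · subst h; simp
    · simp [Function.update_of_ne h, hag j h]
  have e' : Function.update P' ℓ (P ℓ) = P := by
    funext j
    by_cases h : j = ℓ
    · subst h; simp
    · simp [Function.update_of_ne h, hag j h]
  have h1 := hT ℓ P hP (P' ℓ) (hP' ℓ)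
  have h2 := hT ℓ P' hP' (P ℓ) (hP ℓ)
  rw [e] at h1
  rw [e'] at h2
  unfold Mechanism.utility at h1 h2
  linarith

lemma sum_bundle (a : Allocation n m) (ℓ : Fin n) (w : Fin m → ℝ) :
    ∑ t ∈ a.bundle ℓ, w t = ∑ t, w t * if a t = ℓ then 1 else 0 := by
  simp [Allocation.bundle, Finset.sum_filter]

lemma Mechanism.TruthfulOn.wmon_sum {M : Mechanism n m} {D : Fin n → Set (Cost m)}
    (hT : M.TruthfulOn D) {P P' : Profile n m} (hP : ∀ j, P j ∈ D j) (hP' : ∀ j, P' j ∈ D j)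
    (ℓ : Fin n) (hag : ∀ j, j ≠ ℓ → P j = P' j) {u u' : Fin m → ℝ}
    (hu : P ℓ = fun S => ∑ t ∈ S, u t) (hu' : P' ℓ = fun S => ∑ t ∈ S, u' t) :
    ∑ t, (u t - u' t) * ((if M.alloc P t = ℓ then 1 else 0) -
      (if M.alloc P' t = ℓ then 1 else 0)) ≤ 0 := by
  have h := hT.wmon hP hP' ℓ hag
  rw [hu, hu'] at h
  simp only [sum_bundle] at h
  have e : ∑ t, (u t - u' t) * ((if M.alloc P t = ℓ then (1 : ℝ) else 0) -
      (if M.alloc P' t = ℓ then 1 else 0)) =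
      (∑ t, u t * (if M.alloc P t = ℓ then 1 else 0) +
        ∑ t, u' t * (if M.alloc P' t = ℓ then 1 else 0)) -
      (∑ t, u t * (if M.alloc P' t = ℓ then 1 else 0) +
        ∑ t, u' t * (if M.alloc P t = ℓ then 1 else 0)) := by
    rw [← Finset.sum_add_distrib, ← Finset.sum_add_distrib, ← Finset.sum_sub_distrib]
    exact Finset.sum_congr rfl fun t _ => by ring
  rw [e]; linarith

lemma Mechanism.TruthfulOn.wmon_pair {M : Mechanism n m} {D : Fin n → Set (Cost m)}
    (hT : M.TruthfulOn D) {P P' : Profile n m} (hP : ∀ j, P j ∈ D j) (hP' : ∀ j, P' j ∈ D j)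
    (ℓ : Fin n) (hag : ∀ j, j ≠ ℓ → P j = P' j) {u u' : Fin m → ℝ}
    (hu : P ℓ = fun S => ∑ t ∈ S, u t) (hu' : P' ℓ = fun S => ∑ t ∈ S, u' t) {a b : Fin m}
    (hab : a ≠ b) (huu : ∀ t, t ≠ a → t ≠ b → u t = u' t) :
    (u a - u' a) * ((if M.alloc P a = ℓ then 1 else 0) - (if M.alloc P' a = ℓ then 1 else 0)) +
    (u b - u' b) * ((if M.alloc P b = ℓ then 1 else 0) - (if M.alloc P' b = ℓ then 1 else 0))
      ≤ 0 := by
  have h := hT.wmon_sum hP hP' ℓ hag hu hu'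
  rwa [Finset.sum_eq_add a b hab (fun t _ ht => by rw [huu t ht.1 ht.2]; simp) (by simp)
    (by simp)] at h

lemma makespan_le {t : Profile n m} {a : Allocation n m} {O : ℝ} [Nonempty (Fin n)]
    (h : ∀ ℓ, t ℓ (a.bundle ℓ) ≤ O) : makespan t a ≤ O := ciSup_le h

lemma le_makespan (t : Profile n m) (a : Allocation n m) (ℓ : Fin n) :
    t ℓ (a.bundle ℓ) ≤ makespan t a :=
  le_ciSup (f := fun i => t i (a.bundle i)) (Set.finite_range _).bddAbove ℓ

lemma opt_le (t : Profile n m) (a : Allocation n m) : opt t ≤ makespan t a :=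
  ciInf_le (Set.finite_range _).bddBelow a

/-- In an additive profile that has an allocation of makespan at most `O`, no machine receives a
set of tasks of cost greater than `c * O`. -/
lemma Mechanism.ApproxOn.load_le {M : Mechanism n m} {c : ℝ}
    (hM : M.ApproxOn c (additiveDomain n m)) (hc : 0 ≤ c) {W : Fin n → Fin m → ℝ}
    (hW : ∀ ℓ t, 0 ≤ W ℓ t) (a : Allocation n m) {O : ℝ}
    (hO : ∀ ℓ, ∑ t, W ℓ t * (if a t = ℓ then 1 else 0) ≤ O) (ℓ : Fin n) :
    ∑ t, W ℓ t * (if M.alloc (fun ℓ S => ∑ t ∈ S, W ℓ t) t = ℓ then 1 else 0) ≤ c * O := by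
  have : Nonempty (Fin n) := ⟨ℓ⟩
  set P : Profile n m := fun ℓ S => ∑ t ∈ S, W ℓ t with hP
  have h1 := hM P fun k => isAdditive_sum (W k) (hW k)
  have h2 : opt P ≤ O := (opt_le P a).trans (makespan_le fun ℓ => by
    simp only [hP, sum_bundle]; exact hO ℓ)
  have h3 := le_makespan P (M.alloc P) ℓ
  simp only [hP, sum_bundle] at h3
  exact h3.trans (h1.trans (mul_le_mul_of_nonneg_left h2 hc))

lemma Mechanism.ApproxOn.task_le {M : Mechanism n m} {c : ℝ}
    (hM : M.ApproxOn c (additiveDomain n m)) (hc : 0 ≤ c) {W : Fin n → Fin m → ℝ}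
    (hW : ∀ ℓ t, 0 ≤ W ℓ t) (a : Allocation n m) {O : ℝ}
    (hO : ∀ ℓ, ∑ t, W ℓ t * (if a t = ℓ then 1 else 0) ≤ O) (ℓ : Fin n) (t : Fin m)
    (ht : M.alloc (fun ℓ S => ∑ t ∈ S, W ℓ t) t = ℓ) : W ℓ t ≤ c * O := by
  refine le_trans ?_ (hM.load_le hc hW a hO ℓ)
  have := Finset.single_le_sum (f := fun t => W ℓ t *
    (if M.alloc (fun ℓ S => ∑ t ∈ S, W ℓ t) t = ℓ then 1 else 0)) (s := Finset.univ)
    (fun t _ => mul_nonneg (hW ℓ t) (by split_ifs <;> norm_num)) (Finset.mem_univ t)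
  simpa [ht] using this

/-! ### The model of two tasks that is induced by a mechanism -/

/-- The matrix `W` of processing times with the entries of two tasks `a`, `b` replaced. -/
def pairWeights (W : Fin n → Fin m → ℝ) (a b : Fin m) (k i : Fin n) (ta tb x y : ℝ)
    (σ : Finset (Fin n)) (ℓ : Fin n) (t : Fin m) : ℝ :=
  if t = a then (if ℓ = k then ta else if ℓ = i then x else W ℓ a)
  else if t = b then (if ℓ = k then tb else if ℓ = i then y else if ℓ ∈ σ then 0 else W ℓ b)
  else W ℓ t

/-- The profile with processing times `pairWeights` where the root `k` has a discount `d` on the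
pair of tasks `a`, `b`. -/
def pairProfile (W : Fin n → Fin m → ℝ) (a b : Fin m) (k i : Fin n) (ta tb d x y : ℝ)
    (σ : Finset (Fin n)) : Profile n m := fun ℓ S =>
  ∑ t ∈ S, pairWeights W a b k i ta tb x y σ ℓ t - if ℓ = k ∧ a ∈ S ∧ b ∈ S then d else 0

/-- The induced model of two tasks. -/
def Mechanism.pairModel (M : Mechanism n m) (W : Fin n → Fin m → ℝ) (a b : Fin m) (k i : Fin n) :
    PairModel n where
  hA ta tb d x y σ := M.alloc (pairProfile W a b k i ta tb d x y σ) a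
  hB ta tb d x y σ := M.alloc (pairProfile W a b k i ta tb d x y σ) b
  pay ta tb d x y σ := M.pay (pairProfile W a b k i ta tb d x y σ) k -
    ∑ t, (if t = a ∨ t = b then 0 else W k t) *
      if M.alloc (pairProfile W a b k i ta tb d x y σ) t = k then 1 else 0

section

variable {W : Fin n → Fin m → ℝ} {a b : Fin m} {k i : Fin n}

lemma pairWeights_nonneg (hW : ∀ ℓ t, 0 ≤ W ℓ t) {ta tb x y : ℝ} (hta : 0 ≤ ta) (htb : 0 ≤ tb)
    (hx : 0 ≤ x) (hy : 0 ≤ y) (σ : Finset (Fin n)) (ℓ : Fin n) (t : Fin m) :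
    0 ≤ pairWeights W a b k i ta tb x y σ ℓ t := by
  unfold pairWeights
  split_ifs <;> first | assumption | exact le_rfl | exact hW _ _

lemma pairProfile_of_ne {ta tb d x y : ℝ} {σ : Finset (Fin n)} {ℓ : Fin n} (hℓ : ℓ ≠ k) :
    pairProfile W a b k i ta tb d x y σ ℓ =
      fun S => ∑ t ∈ S, pairWeights W a b k i ta tb x y σ ℓ t := by
  funext S
  simp [pairProfile, hℓ]

lemma pairProfile_zero {ta tb x y : ℝ} {σ : Finset (Fin n)} :
    pairProfile W a b k i ta tb 0 x y σ =
      fun ℓ S => ∑ t ∈ S, pairWeights W a b k i ta tb x y σ ℓ t := by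
  funext ℓ S
  simp [pairProfile]

lemma pairProfile_mem (hab : a ≠ b) (hW : ∀ ℓ t, 0 ≤ W ℓ t) {ε E ta tb d x y : ℝ}
    (ht : PairType ε E ta tb d) (hx : 0 ≤ x) (hy : 0 ≤ y) (σ : Finset (Fin n)) (ℓ : Fin n) :
    pairProfile W a b k i ta tb d x y σ ℓ ∈ oneMachineDomain k (nearAdditive m ε E) ℓ := by
  obtain ⟨hta, htb, hd⟩ := ht
  have hnn := pairWeights_nonneg (a := a) (b := b) (k := k) (i := i) hW hta htb hx hy σ
  refine ⟨?_, ?_⟩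
  · rintro rfl
    rcases hd with rfl | ⟨rfl, hE, hε⟩
    · rw [pairProfile_zero]
      exact Or.inl (isAdditive_sum _ (hnn ℓ))
    · refine Or.inr ⟨_, a, b, hab, hnn ℓ, ?_, ?_, ?_⟩
      · simpa [pairWeights] using hE
      · simpa [pairWeights, hab.symm] using hε
      · funext S
        simp [pairProfile, pairWeights]
  · intro hℓ
    rw [pairProfile_of_ne hℓ]
    exact isAdditive_sum _ (hnn ℓ)

lemma root_cost_eq (hab : a ≠ b) {ta tb d x y : ℝ} {σ : Finset (Fin n)} (A : Allocation n m) :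
    pairProfile W a b k i ta tb d x y σ k (A.bundle k) =
      ∑ t, (if t = a ∨ t = b then 0 else W k t) * (if A t = k then 1 else 0) +
        pairLoad k ta tb d (A a) (A b) := by
  have h1 : ∑ t ∈ A.bundle k, pairWeights W a b k i ta tb x y σ k t =
      ∑ t, (if t = a ∨ t = b then 0 else W k t) * (if A t = k then 1 else 0) +
        ((if A a = k then ta else 0) + (if A b = k then tb else 0)) := by
    rw [sum_bundle, ← sub_eq_iff_eq_add', ← Finset.sum_sub_distrib,
      Finset.sum_eq_add a b hab (fun t _ ht => ?_) (by simp) (by simp)]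
    · simp [pairWeights, hab.symm]
    · simp [pairWeights, ht.1, ht.2]
  have h2 : ∀ t, t ∈ A.bundle k ↔ A t = k := by simp [Allocation.bundle]
  simp only [pairProfile, h1, pairLoad, h2, true_and]
  ring

lemma pairLoad_sum_le (hab : a ≠ b) (hik : i ≠ k) (hW : ∀ ℓ t, 0 ≤ W ℓ t) {C : ℝ}
    (hC : ∑ t, W k t ≤ C) {ta tb x y : ℝ} (hta : 0 ≤ ta) (htb : 0 ≤ tb) (hx : 0 ≤ x) (hy : 0 ≤ y)
    (σ : Finset (Fin n)) (q ℓ : Fin n) :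
    ∑ t, pairWeights W a b k i ta tb x y σ ℓ t *
      (if (if t = a then i else if t = b then q else k) = ℓ then 1 else 0) ≤
    C + x + pairWeights W a b k i ta tb x y σ q b := by
  have hnn := pairWeights_nonneg (a := a) (b := b) (k := k) (i := i) hW hta htb hx hy σ
  have hterm : ∀ t, pairWeights W a b k i ta tb x y σ ℓ t *
      (if (if t = a then i else if t = b then q else k) = ℓ then 1 else 0) ≤
      W k t + ((if t = a then x else 0) +
        (if t = b then pairWeights W a b k i ta tb x y σ q b else 0)) := by
    intro t
    by_cases h1 : t = a
    · subst h1
      by_cases h2 : i = ℓ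
      · subst h2; simp [hab, pairWeights, hik, hW k t]
      · simp [h2, hab]; linarith [hW k t]
    · by_cases h2 : t = b
      · subst h2
        by_cases h3 : q = ℓ
        · subst h3; simp [h1, hW k t]
        · simp [h1, h3]; linarith [hW k t, hnn q t]
      · by_cases h3 : k = ℓ
        · subst h3; simp [h1, h2, pairWeights]
        · simp [h1, h2, h3, hW k t]
  refine (Finset.sum_le_sum fun t _ => hterm t).trans ?_
  rw [Finset.sum_add_distrib, Finset.sum_add_distrib]
  simp
  linarith

lemma Mechanism.pairModel_sound {M : Mechanism n m} (hab : a ≠ b) (hik : i ≠ k)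
    (hW : ∀ ℓ t, 0 ≤ W ℓ t) {ε E c C h : ℝ} (hc : 0 ≤ c) (hC : ∑ t, W k t ≤ C)
    (hWa : ∀ z, z ≠ k → z ≠ i → h ≤ W z a) (hWb : ∀ z, z ≠ k → z ≠ i → h ≤ W z b)
    (hT : M.TruthfulOn (oneMachineDomain k (nearAdditive m ε E)))
    (hM : M.ApproxOn c (additiveDomain n m)) :
    (M.pairModel W a b k i).Sound k i ε E c C h where
  root := by
    intro ta tb d ta' tb' d' x y σ ht ht' hx hy _ _
    have e : Function.update (pairProfile W a b k i ta tb d x y σ) k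
        (pairProfile W a b k i ta' tb' d' x y σ k) = pairProfile W a b k i ta' tb' d' x y σ := by
      funext j
      by_cases hj : j = k
      · subst hj; simp
      · rw [Function.update_of_ne hj, pairProfile_of_ne hj, pairProfile_of_ne hj]
        funext S
        refine Finset.sum_congr rfl fun t _ => ?_
        simp [pairWeights, hj]
    have := hT k (pairProfile W a b k i ta tb d x y σ) (pairProfile_mem hab hW ht hx hy σ)
      (pairProfile W a b k i ta' tb' d' x y σ k) (pairProfile_mem hab hW ht' hx hy σ k)
    rw [e] at this
    unfold Mechanism.utility at this
    rw [root_cost_eq hab, root_cost_eq hab] at this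
    simp only [Mechanism.pairModel]
    linarith
  leaf := by
    intro ta tb d x y x' y' σ ht hx hy hx' hy' _ _
    have := hT.wmon_pair (pairProfile_mem (i := i) hab hW ht hx hy σ)
      (pairProfile_mem (i := i) hab hW ht hx' hy' σ) i
      (fun j hj => by
        funext S
        unfold pairProfile
        congr 1
        refine Finset.sum_congr rfl fun t _ => ?_
        simp [pairWeights, hj])
      (pairProfile_of_ne hik) (pairProfile_of_ne hik) hab
      (fun t h1 h2 => by simp [pairWeights, h1, h2])
    simpa [Mechanism.pairModel, pairWeights, hik, hab.symm] using this
  approx := by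
    intro ta tb x y σ O hta htb hx hy hk hi hO
    have hnn := pairWeights_nonneg (a := a) (b := b) (k := k) (i := i) hW hta htb hx hy σ
    -- In the comparison allocation a goes to leaf i, b to machine q and the rest to the root.
    obtain ⟨q, hq⟩ : ∃ q, C + x + pairWeights W a b k i ta tb x y σ q b ≤ O := by
      rcases hO with hO | hO | ⟨⟨z, hz⟩, hO⟩
      · exact ⟨k, by simpa [pairWeights, hab.symm] using hO⟩
      · exact ⟨i, by simpa [pairWeights, hab.symm, hik] using hO⟩
      · have hzk : z ≠ k := fun e => hk (e ▸ hz)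
        have hzi : z ≠ i := fun e => hi (e ▸ hz)
        exact ⟨z, by simpa [pairWeights, hab.symm, hzk, hzi, hz] using hO⟩
    have key : ∀ ℓ t, M.alloc (pairProfile W a b k i ta tb 0 x y σ) t = ℓ →
        pairWeights W a b k i ta tb x y σ ℓ t ≤ c * O := by
      intro ℓ t hℓ
      rw [pairProfile_zero] at hℓ
      exact hM.task_le hc hnn (fun t => if t = a then i else if t = b then q else k)
        (fun ℓ => (pairLoad_sum_le hab hik hW hC hta htb hx hy σ q ℓ).trans hq) ℓ t hℓ
    simp only [Mechanism.pairModel]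
    refine ⟨fun e => ?_, fun e => ?_, fun e1 e2 => ?_, fun e => ?_, fun e => ?_, fun e1 e2 e3 => ?_⟩
    · simpa [pairWeights] using key k a e
    · simpa [pairWeights, hik] using key i a e
    · have := key _ a rfl
      simp only [pairWeights, e1, e2, if_true, if_false] at this
      exact (hWa _ e1 e2).trans this
    · simpa [pairWeights, hab.symm] using key k b e
    · simpa [pairWeights, hik, hab.symm] using key i b e
    · have := key _ b rfl
      simp only [pairWeights, e1, e2, e3, hab.symm, if_true, if_false] at this
      exact (hWb _ e1 e2).trans this

/-- For a leaf `z ≠ i`, two costs of `a` that differ by more than `h` cannot both be such that the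
leaf changes its mind about `a` when the cost of `b` drops from `h` to `0`. -/
lemma Mechanism.TruthfulOn.not_both_bad {M : Mechanism n m} (hab : a ≠ b) {ε E h : ℝ}
    (hT : M.TruthfulOn (oneMachineDomain k (nearAdditive m ε E)))
    {W' : Fin n → Fin m → ℝ} (hW : ∀ ℓ t, 0 ≤ W ℓ t) (hW' : ∀ ℓ t, 0 ≤ W' ℓ t) {z : Fin n}
    (hzk : z ≠ k) (hzi : z ≠ i) (hWW : ∀ ℓ t, (ℓ, t) ≠ (z, a) → W ℓ t = W' ℓ t) (hh : 0 ≤ h)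
    (hb : W z b = h) (hlt : W z a + h < W' z a) {ta tb d x y : ℝ} (ht : PairType ε E ta tb d)
    (hx : 0 ≤ x) (hy : 0 ≤ y) {σ : Finset (Fin n)} (hzσ : z ∉ σ)
    (hbad : ¬ (M.alloc (pairProfile W a b k i ta tb d x y σ) a = z ↔
      M.alloc (pairProfile W a b k i ta tb d x y (insert z σ)) a = z)) :
    M.alloc (pairProfile W' a b k i ta tb d x y σ) a ≠ z ∧
      M.alloc (pairProfile W' a b k i ta tb d x y (insert z σ)) a ≠ z := by
  have hb' : W' z b = h := by rw [← hWW z b (by simp [hab.symm]), hb]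
  -- The change in the cost of b contributes at most h, which the rise in the cost of a outweighs: a
  -- leaf without a before the rise has none after it.
  have key : ∀ τ τ' : Finset (Fin n), (τ = σ ∨ τ = insert z σ) → (τ' = σ ∨ τ' = insert z σ) →
      M.alloc (pairProfile W a b k i ta tb d x y τ) a ≠ z →
      M.alloc (pairProfile W' a b k i ta tb d x y τ') a ≠ z := by
    intro τ τ' hτ hτ' h0 h1
    have hmem : ∀ j, j ≠ z → (j ∈ τ ↔ j ∈ τ') := by
      intro j hj
      rcases hτ with rfl | rfl <;> rcases hτ' with rfl | rfl <;> simp [hj]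
    have := hT.wmon_pair (pairProfile_mem (i := i) hab hW ht hx hy τ)
      (pairProfile_mem (i := i) hab hW' ht hx hy τ') z
      (fun j hj => by
        funext S
        unfold pairProfile
        congr 1
        refine Finset.sum_congr rfl fun t _ => ?_
        unfold pairWeights
        simp only [hmem j hj, hWW j a (by simp [hj]), hWW j b (by simp [hj]),
          hWW j t (by simp [hj])])
      (pairProfile_of_ne hzk) (pairProfile_of_ne hzk) hab
      (fun t h1 h2 => by simp [pairWeights, h1, h2, hWW z t (by simp [h1])])
    simp only [pairWeights, hzk, hzi, h0, h1, hab.symm, hb, hb', if_true, if_false] at this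
    split_ifs at this <;> linarith
  by_cases h0 : M.alloc (pairProfile W a b k i ta tb d x y σ) a = z
  · have h1 : M.alloc (pairProfile W a b k i ta tb d x y (insert z σ)) a ≠ z :=
      fun h1 => hbad ⟨fun _ => h1, fun _ => h0⟩
    exact ⟨key _ _ (Or.inr rfl) (Or.inl rfl) h1, key _ _ (Or.inr rfl) (Or.inr rfl) h1⟩
  · exact ⟨key _ _ (Or.inl rfl) (Or.inl rfl) h0, key _ _ (Or.inl rfl) (Or.inr rfl) h0⟩

end

/-! ### The star of root and leaves -/

/-- The additive profile with processing times `W`. -/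
def sumProfile (W : Fin n → Fin m → ℝ) : Profile n m := fun ℓ S => ∑ t ∈ S, W ℓ t

/-- The leaves: all machines but the root `k`. -/
abbrev Leaf (k : Fin n) : Type := {i : Fin n // i ≠ k}

section Star

variable {k : Fin n} (e : Leaf k ⊕ Leaf k ↪ Fin m)

/-- The processing times of the root: the first tasks of the leaves in `J` take time `γ`, all other
tasks take time `κ`. -/
noncomputable def rootWeights (J : Finset (Leaf k)) (γ κ : ℝ) : Fin m → ℝ :=
  Function.extend e (Sum.elim (fun j => if j ∈ J then γ else κ) fun _ => κ) fun _ => κ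

/-- The processing times of the leaf `ℓ`: its own two tasks take times `x ℓ` and `y ℓ`. -/
noncomputable def leafWeights (X : Leaf k → Leaf k → ℝ) (h : ℝ) (x y : Leaf k → ℝ) (ℓ : Leaf k) :
    Fin m → ℝ :=
  Function.extend e (Sum.elim (fun j => if j = ℓ then x j else X j ℓ)
    fun j => if j = ℓ then y j else h) fun _ => 1

/-- The processing times of all machines. -/
noncomputable def starWeights (J : Finset (Leaf k)) (γ κ : ℝ) (X : Leaf k → Leaf k → ℝ) (h : ℝ)
    (x y : Leaf k → ℝ) : Fin n → Fin m → ℝ := fun ℓ =>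
  if hℓ : ℓ = k then rootWeights e J γ κ else leafWeights e X h x y ⟨ℓ, hℓ⟩

variable {e} {J : Finset (Leaf k)} {γ κ h : ℝ} {X : Leaf k → Leaf k → ℝ} {x y : Leaf k → ℝ}

lemma starWeights_root : starWeights e J γ κ X h x y k = rootWeights e J γ κ := by
  simp [starWeights]

lemma starWeights_leaf (ℓ : Leaf k) :
    starWeights e J γ κ X h x y ℓ = leafWeights e X h x y ℓ := by
  simp [starWeights, ℓ.2]

lemma starWeights_of_ne {ℓ : Fin n} (hℓ : ℓ ≠ k) :
    starWeights e J γ κ X h x y ℓ = leafWeights e X h x y ⟨ℓ, hℓ⟩ := by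
  simp [starWeights, hℓ]

@[simp] lemma rootWeights_inl (j : Leaf k) :
    rootWeights e J γ κ (e (Sum.inl j)) = if j ∈ J then γ else κ := by
  simp [rootWeights, e.injective.extend_apply]

@[simp] lemma rootWeights_inr (j : Leaf k) : rootWeights e J γ κ (e (Sum.inr j)) = κ := by
  simp [rootWeights, e.injective.extend_apply]

lemma rootWeights_of_notMem {t : Fin m} (ht : ¬ ∃ u, e u = t) : rootWeights e J γ κ t = κ := by
  simp only [rootWeights]
  rw [Function.extend_apply' _ _ _ ht]

@[simp] lemma leafWeights_inl (j ℓ : Leaf k) :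
    leafWeights e X h x y ℓ (e (Sum.inl j)) = if j = ℓ then x j else X j ℓ := by
  simp [leafWeights, e.injective.extend_apply]

@[simp] lemma leafWeights_inr (j ℓ : Leaf k) :
    leafWeights e X h x y ℓ (e (Sum.inr j)) = if j = ℓ then y j else h := by
  simp [leafWeights, e.injective.extend_apply]

lemma leafWeights_of_notMem {ℓ : Leaf k} {t : Fin m} (ht : ¬ ∃ u, e u = t) :
    leafWeights e X h x y ℓ t = 1 := by
  simp only [leafWeights]
  rw [Function.extend_apply' _ _ _ ht]

lemma task_cases {t : Fin m} {p : Fin m → Prop} (h1 : ∀ j, p (e (Sum.inl j)))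
    (h2 : ∀ j, p (e (Sum.inr j))) (h3 : (¬ ∃ u, e u = t) → p t) : p t := by
  by_cases ht : ∃ u, e u = t
  · obtain ⟨u | u, rfl⟩ := ht
    · exact h1 u
    · exact h2 u
  · exact h3 ht

lemma le_rootWeights {a : ℝ} (h1 : a ≤ γ) (h2 : a ≤ κ) (t : Fin m) :
    a ≤ rootWeights e J γ κ t := by
  refine task_cases (e := e) (p := fun t => a ≤ rootWeights e J γ κ t) (fun j => ?_) (fun j => ?_)
    fun ht => ?_
  · rw [rootWeights_inl]; split_ifs <;> assumption
  · rwa [rootWeights_inr]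
  · rwa [rootWeights_of_notMem ht]

lemma rootWeights_le {a : ℝ} (h1 : γ ≤ a) (h2 : κ ≤ a) (t : Fin m) :
    rootWeights e J γ κ t ≤ a := by
  refine task_cases (e := e) (p := fun t => rootWeights e J γ κ t ≤ a) (fun j => ?_) (fun j => ?_)
    fun ht => ?_
  · rw [rootWeights_inl]; split_ifs <;> assumption
  · rwa [rootWeights_inr]
  · rwa [rootWeights_of_notMem ht]

lemma le_leafWeights {a : ℝ} (h1 : ∀ j, a ≤ x j) (h2 : ∀ j, a ≤ y j) (h3 : ∀ j ℓ, a ≤ X j ℓ)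
    (h4 : a ≤ h) (h5 : a ≤ 1) (ℓ : Leaf k) (t : Fin m) : a ≤ leafWeights e X h x y ℓ t := by
  refine task_cases (e := e) (p := fun t => a ≤ leafWeights e X h x y ℓ t) (fun j => ?_)
    (fun j => ?_) fun ht => ?_
  · rw [leafWeights_inl]; split_ifs
    exacts [h1 _, h3 _ _]
  · rw [leafWeights_inr]; split_ifs
    exacts [h2 _, h4]
  · rwa [leafWeights_of_notMem ht]

lemma starWeights_nonneg (hγ : 0 ≤ γ) (hκ : 0 ≤ κ) (h1 : ∀ j, 0 ≤ x j) (h2 : ∀ j, 0 ≤ y j)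
    (h3 : ∀ j ℓ, 0 ≤ X j ℓ) (h4 : 0 ≤ h) (ℓ : Fin n) (t : Fin m) :
    0 ≤ starWeights e J γ κ X h x y ℓ t := by
  by_cases hℓ : ℓ = k
  · subst hℓ; rw [starWeights_root]; exact le_rootWeights hγ hκ t
  · rw [starWeights_of_ne hℓ]; exact le_leafWeights h1 h2 h3 h4 zero_le_one _ t

/-- Replacing the entries of the two tasks of the leaf `i` in a matrix of processing times. -/
lemma pairWeights_starWeights {J' : Finset (Leaf k)} {i : Leaf k} {ta : ℝ}
    (hJ : ∀ j, j ≠ i → (j ∈ J' ↔ j ∈ J)) (hta : ta = if i ∈ J' then γ else κ) (xi yi : ℝ) :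
    pairWeights (starWeights e J γ κ X h x y) (e (Sum.inl i)) (e (Sum.inr i)) k i ta κ xi yi ∅ =
      starWeights e J' γ κ X h (Function.update x i xi) (Function.update y i yi) := by
  funext ℓ t
  by_cases hℓ : ℓ = k
  · subst hℓ
    rw [starWeights_root]
    unfold pairWeights
    rw [starWeights_root]
    refine task_cases (e := e) (p := fun t => (if t = e (Sum.inl i) then
      (if ℓ = ℓ then ta else if ℓ = i then xi else rootWeights e J γ κ (e (Sum.inl i)))
      else if t = e (Sum.inr i) then (if ℓ = ℓ then κ else if ℓ = i then yi else
        if ℓ ∈ (∅ : Finset (Fin n)) then 0 else rootWeights e J γ κ (e (Sum.inr i)))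
      else rootWeights e J γ κ t) = rootWeights e J' γ κ t) (fun j => ?_) (fun j => ?_) fun ht => ?_
    · by_cases hj : j = i
      · subst hj; simp [hta]
      · simp [hj, hJ j hj]
    · by_cases hj : j = i
      · subst hj; simp
      · simp [hj]
    · rw [rootWeights_of_notMem ht, rootWeights_of_notMem ht, if_neg (fun h => ht ⟨_, h.symm⟩),
        if_neg (fun h => ht ⟨_, h.symm⟩)]
  · have hi : (ℓ = i.1) ↔ (⟨ℓ, hℓ⟩ : Leaf k) = i := by rw [Subtype.ext_iff]
    rw [starWeights_of_ne hℓ]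
    unfold pairWeights
    rw [starWeights_of_ne hℓ]
    simp only [hℓ, if_false, hi, Finset.notMem_empty]
    generalize (⟨ℓ, hℓ⟩ : Leaf k) = z
    refine task_cases (e := e) (p := fun t => (if t = e (Sum.inl i) then
      (if z = i then xi else leafWeights e X h x y z (e (Sum.inl i)))
      else if t = e (Sum.inr i) then (if z = i then yi else
        leafWeights e X h x y z (e (Sum.inr i)))
      else leafWeights e X h x y z t) =
      leafWeights e X h (Function.update x i xi) (Function.update y i yi) z t)
      (fun j => ?_) (fun j => ?_) fun ht => ?_
    · by_cases hj : j = i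
      · subst hj
        by_cases hz : z = j
        · subst hz; simp
        · simp [hz, Ne.symm hz]
      · simp [hj]
    · by_cases hj : j = i
      · subst hj
        by_cases hz : z = j
        · subst hz; simp
        · simp [hz, Ne.symm hz]
      · simp [hj]
    · rw [leafWeights_of_notMem ht, leafWeights_of_notMem ht, if_neg (fun h => ht ⟨_, h.symm⟩),
        if_neg (fun h => ht ⟨_, h.symm⟩)]

end Star

lemma sumProfile_mem {ε E : ℝ} {k : Fin n} {W : Fin n → Fin m → ℝ} (hW : ∀ ℓ t, 0 ≤ W ℓ t)
    (ℓ : Fin n) : sumProfile W ℓ ∈ oneMachineDomain k (nearAdditive m ε E) ℓ :=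
  ⟨fun _ => Or.inl (isAdditive_sum _ (hW ℓ)), fun _ => isAdditive_sum _ (hW ℓ)⟩

/-- A root that receives all the tasks still does so when every task that it might lose becomes
strictly cheaper. -/
lemma Mechanism.TruthfulOn.root_all {M : Mechanism n m} {ε E : ℝ} {k : Fin n}
    (hT : M.TruthfulOn (oneMachineDomain k (nearAdditive m ε E))) {W W' : Fin n → Fin m → ℝ}
    (hW : ∀ ℓ t, 0 ≤ W ℓ t) (hW' : ∀ ℓ t, 0 ≤ W' ℓ t) (hag : ∀ ℓ, ℓ ≠ k → W ℓ = W' ℓ)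
    (hall : ∀ t, M.alloc (sumProfile W) t = k)
    (hlt : ∀ t, M.alloc (sumProfile W') t ≠ k → W' k t < W k t) (t : Fin m) :
    M.alloc (sumProfile W') t = k := by
  have h := hT.wmon_sum (P := sumProfile W) (P' := sumProfile W') (sumProfile_mem hW)
    (sumProfile_mem hW') k (fun j hj => by unfold sumProfile; rw [hag j hj]) rfl rfl
  have hnn : ∀ t ∈ Finset.univ, 0 ≤ (W k t - W' k t) *
      ((if M.alloc (sumProfile W) t = k then (1 : ℝ) else 0) -
        (if M.alloc (sumProfile W') t = k then 1 else 0)) := by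
    intro t _
    by_cases ht : M.alloc (sumProfile W') t = k
    · simp [hall t, ht]
    · simpa [hall t, ht] using (hlt t ht).le
  by_contra ht
  have h0 := (Finset.sum_eq_zero_iff_of_nonneg hnn).1 (le_antisymm h (Finset.sum_nonneg hnn)) t
    (Finset.mem_univ t)
  simp only [hall t, ht, if_true, if_false, sub_zero, mul_one] at h0
  linarith [hlt t ht]

/-! ### Generic costs of the leaves -/

section Generic

variable {k : Fin n} {h : ℝ}

/-- Costs of the leaves for the first tasks of the other leaves that avoid the finitely many
exceptional values. -/
lemma exists_generic_costs {M : Mechanism n m} {ε E : ℝ} (e : Leaf k ⊕ Leaf k ↪ Fin m)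
    (hT : M.TruthfulOn (oneMachineDomain k (nearAdditive m ε E))) (hh : 0 ≤ h) {γ κ : ℕ → ℝ}
    (hγ : ∀ p, 0 ≤ γ p) (hκ : ∀ p, 0 ≤ κ p) {A : ℝ} {I : Type*} [Fintype I] {xv yv : I → ℝ}
    (hx : ∀ p, 0 ≤ xv p) (hy : ∀ p, 0 ≤ yv p) {T : Finset ℝ}
    (ht : ∀ β ∈ T, PairType ε E A β A) :
    ∃ X : Leaf k → Leaf k → ℝ, (∀ j ℓ, h ≤ X j ℓ) ∧
      ∀ (i : Leaf k) (J : Finset (Leaf k)) (o : Leaf k → I) (p : I), ∀ β ∈ T,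
      ∀ (σ : Finset (Fin n)) (z : Fin n), z ≠ k → z ≠ i → z ∉ σ →
      (M.alloc (pairProfile (starWeights e J (γ J.card) (κ J.card) X h (xv ∘ o) (yv ∘ o))
        (e (Sum.inl i)) (e (Sum.inr i)) k i A β A (xv p) (yv p) σ) (e (Sum.inl i)) = z ↔
      M.alloc (pairProfile (starWeights e J (γ J.card) (κ J.card) X h (xv ∘ o) (yv ∘ o))
        (e (Sum.inl i)) (e (Sum.inr i)) k i A β A (xv p) (yv p) (insert z σ))
        (e (Sum.inl i)) = z) := by
  classical
  set Ev := Leaf k × Leaf k × Finset (Leaf k) × (Leaf k → I) × I × {β // β ∈ T} × Finset (Fin n)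
  set K := Fintype.card Ev + 1 with hK
  -- The spacing h + 1 exceeds h, so by `not_both_bad` each event excludes at most one value of its
  -- coordinate.
  set c : (Leaf k × Leaf k → Fin K) → Leaf k → Leaf k → ℝ :=
    fun X j ℓ => h + (h + 1) * ((X (j, ℓ) : ℕ) : ℝ) with hc
  have hch : ∀ X j ℓ, h ≤ c X j ℓ := fun X j ℓ => le_add_of_nonneg_right (by positivity)
  obtain ⟨X, hX⟩ := exists_avoiding (V := Leaf k × Leaf k) (Ev := Ev) K (Nat.lt_succ_self _)
    (fun v => (v.1, v.2.1))
    (fun v X => match v with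
      | (i, z, J, o, p, β, σ) => z ≠ i ∧ z.1 ∉ σ ∧
        ¬ (M.alloc (pairProfile (starWeights e J (γ J.card) (κ J.card) (c X) h (xv ∘ o) (yv ∘ o))
        (e (Sum.inl i)) (e (Sum.inr i)) k i A β A (xv p) (yv p) σ) (e (Sum.inl i)) = z ↔
      M.alloc (pairProfile (starWeights e J (γ J.card) (κ J.card) (c X) h (xv ∘ o) (yv ∘ o))
        (e (Sum.inl i)) (e (Sum.inr i)) k i A β A (xv p) (yv p) (insert z.1 σ))
        (e (Sum.inl i)) = z)) (by
    rintro ⟨i, z, J, o, p, β, σ⟩ X X' hXX ⟨hzi, hzσ, hb⟩ ⟨-, -, hb'⟩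
    simp only at hXX
    have key : ∀ X X' : Leaf k × Leaf k → Fin K, (∀ u, u ≠ (i, z) → X u = X' u) →
        X (i, z) < X' (i, z) →
        ¬ (M.alloc (pairProfile (starWeights e J (γ J.card) (κ J.card) (c X) h (xv ∘ o) (yv ∘ o))
          (e (Sum.inl i)) (e (Sum.inr i)) k i A β A (xv p) (yv p) σ) (e (Sum.inl i)) = z ↔
        M.alloc (pairProfile (starWeights e J (γ J.card) (κ J.card) (c X) h (xv ∘ o) (yv ∘ o))
          (e (Sum.inl i)) (e (Sum.inr i)) k i A β A (xv p) (yv p) (insert z.1 σ))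
          (e (Sum.inl i)) = z) →
        (M.alloc (pairProfile (starWeights e J (γ J.card) (κ J.card) (c X') h (xv ∘ o) (yv ∘ o))
          (e (Sum.inl i)) (e (Sum.inr i)) k i A β A (xv p) (yv p) σ) (e (Sum.inl i)) = z ↔
        M.alloc (pairProfile (starWeights e J (γ J.card) (κ J.card) (c X') h (xv ∘ o) (yv ∘ o))
          (e (Sum.inl i)) (e (Sum.inr i)) k i A β A (xv p) (yv p) (insert z.1 σ))
          (e (Sum.inl i)) = z) := by
      intro X X' hXX hlt hb
      have hnn : ∀ X, ∀ ℓ t, 0 ≤ starWeights e J (γ J.card) (κ J.card) (c X) h (xv ∘ o) (yv ∘ o)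
          ℓ t := fun X => starWeights_nonneg (hγ _) (hκ _) (fun j => hx _) (fun j => hy _)
            (fun j ℓ => hh.trans (hch X j ℓ)) hh
      have := hT.not_both_bad (e.injective.ne Sum.inl_ne_inr) (hnn X) (hnn X') z.2
        (fun hz => hzi (Subtype.ext hz)) ?_ hh ?_ ?_ (ht β β.2) (hx p) (hy p) hzσ hb
      · exact ⟨fun h1 => absurd h1 this.1, fun h1 => absurd h1 this.2⟩
      · intro ℓ t hne
        by_cases hℓ : ℓ = k
        · subst hℓ; rw [starWeights_root, starWeights_root]
        · rw [starWeights_of_ne hℓ, starWeights_of_ne hℓ]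
          by_cases hu : ∃ u, e u = t
          · obtain ⟨j | j, rfl⟩ := hu
            · simp only [leafWeights_inl]
              split_ifs with hj
              · rfl
              · have : X (j, ⟨ℓ, hℓ⟩) = X' (j, ⟨ℓ, hℓ⟩) := hXX _ fun hu => hne (by
                  rw [Prod.mk.injEq] at hu
                  rw [← hu.1, ← hu.2])
                simp only [hc, this]
            · simp
          · rw [leafWeights_of_notMem hu, leafWeights_of_notMem hu]
      · rw [starWeights_leaf, leafWeights_inr, if_neg hzi.symm]
      · rw [starWeights_leaf, starWeights_leaf, leafWeights_inl, leafWeights_inl,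
          if_neg hzi.symm, if_neg hzi.symm]
        have h1 : (((X (i, z) : ℕ) : ℝ)) + 1 ≤ ((X' (i, z) : ℕ) : ℝ) := by exact_mod_cast hlt
        have h2 := mul_le_mul_of_nonneg_left h1 (by linarith : 0 ≤ h + 1)
        simp only [hc]
        linarith
    funext u
    by_cases hu : u = (i, z)
    · subst hu
      rcases lt_trichotomy (X (i, z)) (X' (i, z)) with h1 | h1 | h1
      · exact absurd (key X X' hXX h1 hb) hb'
      · exact h1
      · exact absurd (key X' X (fun u hu => (hXX u hu).symm) h1 hb') hb
    · exact hXX u hu)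
  refine ⟨c X, hch X, fun i J o p β hβ σ z hzk hzi hzσ => ?_⟩
  have := hX (i, ⟨z, hzk⟩, J, o, p, ⟨β, hβ⟩, σ)
  simp only [not_and, not_not] at this
  exact this (fun h => hzi (congrArg Subtype.val h)) hzσ

end Generic

/-! ### Induction over the leaves -/

section Claim

variable {ε c C Γ x₀ : ℝ}

/-- Indices for the pairs of processing times that a leaf may have for its two tasks. -/
abbrev Grid.Index (G : Grid n ε c C Γ x₀) : Type := Fin (G.M + 1) × Fin (G.Q * G.d + 3)

/-- The processing time of a leaf for its first task. -/
noncomputable def Grid.xval (G : Grid n ε c C Γ x₀) (p : G.Index) : ℝ :=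
  if p.1 = 0 then x₀ else (p.1 : ℕ) * G.w

/-- The processing time of a leaf for its second task. -/
noncomputable def Grid.yval (G : Grid n ε c C Γ x₀) (p : G.Index) : ℝ :=
  G.Y + (p.2 : ℕ) * G.w

lemma Grid.xval_zero (G : Grid n ε c C Γ x₀) : G.xval 0 = x₀ := by simp [Grid.xval]

lemma Grid.yval_zero (G : Grid n ε c C Γ x₀) : G.yval 0 = G.Y := by simp [Grid.yval]

lemma Grid.w_lt (G : Grid n ε c C Γ x₀) : G.w < x₀ := by
  have h1 : (1 : ℝ) ≤ G.M := by exact_mod_cast (by have := G.hMd; omega : 1 ≤ G.M)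
  nlinarith [G.hMx, G.hw]

lemma Grid.le_xval (G : Grid n ε c C Γ x₀) (p : G.Index) : G.w ≤ G.xval p := by
  unfold Grid.xval
  split_ifs with h
  · exact G.w_lt.le
  · have : (1 : ℝ) ≤ (p.1 : ℕ) := by
      exact_mod_cast Nat.one_le_iff_ne_zero.2 fun h0 => h (Fin.ext h0)
    nlinarith [G.hw]

lemma Grid.le_yval (G : Grid n ε c C Γ x₀) (p : G.Index) : G.Y ≤ G.yval p :=
  le_add_of_nonneg_right (mul_nonneg (Nat.cast_nonneg _) G.hw.le)

lemma Grid.exists_index (G : Grid n ε c C Γ x₀) {j l : ℕ} (h1 : 1 ≤ j) (hj : j ≤ G.M)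
    (hl : l ≤ G.Q * G.d + 2) : ∃ p : G.Index, G.xval p = j * G.w ∧ G.yval p = G.Y + l * G.w := by
  refine ⟨(⟨j, by omega⟩, ⟨l, by omega⟩), ?_, rfl⟩
  have : (⟨j, by omega⟩ : Fin (G.M + 1)) ≠ 0 := fun h => by
    have := congrArg Fin.val h
    simp at this
    omega
  simp only [Grid.xval, this, if_false]

variable {k : Fin n} {e : Leaf k ⊕ Leaf k ↪ Fin m} {X : Leaf k → Leaf k → ℝ}

lemma Grid.scales (G : Grid n ε c C Γ x₀) (hc : 1 ≤ c) (hC : 0 ≤ C) {κ : ℝ} (hκ : 0 < κ)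
    (hκ1 : κ ≤ 1) : Scales ε G.A c C x₀ κ G.A G.Y G.Y' G.h :=
  ⟨hc, hC, (G.hw.trans G.w_lt).le, hκ, hκ1, G.hA, le_rfl, G.hY, G.hh, G.hYY⟩

lemma Grid.one_le_Y (G : Grid n ε c C Γ x₀) (hc : 1 ≤ c) (hC : 0 ≤ C) : 1 ≤ G.Y := by
  have := G.hw.trans G.w_lt
  nlinarith [G.hY]

lemma Grid.one_le_h (G : Grid n ε c C Γ x₀) (hc : 1 ≤ c) (hC : 0 ≤ C) : 1 ≤ G.h := by
  have := G.hw.trans G.w_lt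
  nlinarith [G.hh, G.hYY, G.one_le_Y hc hC]

lemma Grid.weights_nonneg (G : Grid n ε c C Γ x₀) (hc : 1 ≤ c) (hC : 0 ≤ C)
    (hX : ∀ j ℓ, G.h ≤ X j ℓ) {J : Finset (Leaf k)} {γ κ : ℝ} (hγ : 0 ≤ γ) (hκ : 0 ≤ κ)
    (o : Leaf k → G.Index) (ℓ : Fin n) (t : Fin m) :
    0 ≤ starWeights e J γ κ X G.h (G.xval ∘ o) (G.yval ∘ o) ℓ t := by
  have h1 := G.one_le_h hc hC
  have h2 := G.one_le_Y hc hC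
  exact starWeights_nonneg hγ hκ (fun j => G.hw.le.trans (G.le_xval _))
    (fun j => (zero_le_one.trans h2).trans (G.le_yval (o j)))
    (fun j ℓ => by linarith [hX j ℓ]) (by linarith) ℓ t

lemma rootWeights_lt {J : Finset (Leaf k)} {γ κ γ' κ' : ℝ} (h1 : γ' < γ) (h2 : κ' < κ)
    (t : Fin m) : rootWeights e J γ' κ' t < rootWeights e J γ κ t := by
  refine task_cases (e := e) (p := fun t => rootWeights e J γ' κ' t < rootWeights e J γ κ t)
    (fun j => ?_) (fun j => ?_) fun ht => ?_
  · simp only [rootWeights_inl]; split_ifs <;> assumption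
  · simpa only [rootWeights_inr] using h2
  · simpa only [rootWeights_of_notMem ht] using h2

lemma rootWeights_congr {J J' : Finset (Leaf k)} {γ κ : ℝ} {i : Leaf k}
    (hJ : ∀ j, j ≠ i → (j ∈ J' ↔ j ∈ J)) {t : Fin m} (ht : t ≠ e (Sum.inl i)) :
    rootWeights e J' γ κ t = rootWeights e J γ κ t := by
  by_cases hu : ∃ u, e u = t
  · obtain ⟨j | j, rfl⟩ := hu
    · simp only [rootWeights_inl, hJ j fun h => ht (h ▸ rfl)]
    · simp
  · rw [rootWeights_of_notMem hu, rootWeights_of_notMem hu]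

/-- If all tasks are nearly free for the root then it receives all of them. -/
lemma Grid.root_all_of_cheap (G : Grid n ε c C Γ x₀) (hc : 1 ≤ c) (hC : 0 ≤ C) {M : Mechanism n m}
    (hM : M.ApproxOn c (additiveDomain n m)) (hX : ∀ j ℓ, G.h ≤ X j ℓ) {γ κ : ℝ} (hγ : 0 ≤ γ)
    (hκ : 0 ≤ κ) (hκm : c * (m * κ) < min G.w 1) (o : Leaf k → G.Index) (t : Fin m) :
    M.alloc (sumProfile (starWeights e ∅ γ κ X G.h (G.xval ∘ o) (G.yval ∘ o))) t = k := by
  by_contra ht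
  have h1 := G.one_le_h hc hC
  have h2 := G.one_le_Y hc hC
  have hroot : ∀ t, rootWeights e ∅ γ κ t = κ := fun t => by
    refine task_cases (e := e) (p := fun t => rootWeights e ∅ γ κ t = κ) (fun j => by simp)
      (fun j => by simp) rootWeights_of_notMem
  have hle := hM.task_le (by linarith) (G.weights_nonneg (e := e) hc hC hX hγ hκ (J := ∅) o)
    (fun _ => k) (O := m * κ) (fun ℓ => by
      by_cases hℓ : k = ℓ
      · subst hℓ
        simp only [starWeights_root, hroot]
        simp
      · simp only [hℓ, if_false, mul_zero, Finset.sum_const_zero]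
        positivity) _ t rfl
  rw [show (fun ℓ S => ∑ t ∈ S, starWeights e ∅ γ κ X G.h (G.xval ∘ o) (G.yval ∘ o) ℓ t) =
    sumProfile (starWeights e ∅ γ κ X G.h (G.xval ∘ o) (G.yval ∘ o)) from rfl,
    starWeights_of_ne ht] at hle
  have hw1 : min G.w 1 ≤ 1 := min_le_right _ _
  have := le_leafWeights (e := e) (a := min G.w 1) (X := X) (h := G.h) (x := G.xval ∘ o)
    (y := G.yval ∘ o) (fun j => (min_le_left _ _).trans (G.le_xval _))
    (fun j => (hw1.trans h2).trans (G.le_yval (o j))) (fun j ℓ => by linarith [hX j ℓ])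
    (by linarith) hw1 ⟨_, ht⟩ t
  linarith

/-- The root keeps receiving all the tasks when its processing times for the first tasks of the
leaves are raised, one after the other. -/
theorem Grid.root_all (G : Grid n ε c C Γ x₀) (hε : 0 ≤ ε) (hc : 1 ≤ c) (hC : 0 ≤ C)
    (hCΓ : m * Γ ≤ C) {M : Mechanism n m}
    (hT : M.TruthfulOn (oneMachineDomain k (nearAdditive m ε G.A)))
    (hM : M.ApproxOn c (additiveDomain n m)) {γ κ : ℕ → ℝ} (hγ : StrictAnti γ)
    (hκ : StrictAnti κ) (hγ1 : ∀ p, 1 ≤ γ p) (hγΓ : ∀ p, γ p ≤ Γ) (hκ0 : ∀ p, 0 < κ p)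
    (hκ1 : ∀ p, κ p ≤ 1) (hκm : c * (m * κ 0) < min G.w 1) :
    ∃ X : Leaf k → Leaf k → ℝ, (∀ j ℓ, G.h ≤ X j ℓ) ∧ ∀ J : Finset (Leaf k),
      ∀ o : Leaf k → G.Index, (∀ j ∈ J, o j = 0) → ∀ t,
      M.alloc (sumProfile (starWeights e J (γ J.card) (κ J.card) X G.h (G.xval ∘ o)
        (G.yval ∘ o))) t = k := by
  classical
  have hh := G.one_le_h hc hC
  have hY := G.one_le_Y hc hC
  have hγ0 : ∀ p, 0 ≤ γ p := fun p => zero_le_one.trans (hγ1 p)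
  obtain ⟨X, hX, hgood⟩ := exists_generic_costs e hT (by linarith : 0 ≤ G.h) hγ0
    (xv := G.xval) (yv := G.yval)
    (fun p => (hκ0 p).le) (fun p => G.hw.le.trans (G.le_xval p))
    (fun p => (zero_le_one.trans hY).trans (G.le_yval p)) (A := G.A) (T := G.T) (fun β hβ => by
      have hA0 : 0 ≤ G.A := by
        have := G.hA
        have := G.hw.trans G.w_lt
        nlinarith
      have hb := G.hTb β hβ
      exact ⟨hA0, G.hb0.trans hb, Or.inr ⟨rfl, le_rfl,
        G.hAb.trans (mul_le_mul_of_nonneg_left hb hε)⟩⟩)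
  refine ⟨X, hX, fun J => ?_⟩
  have hnn : ∀ (J : Finset (Leaf k)) (p : ℕ) (o : Leaf k → G.Index) ℓ t, 0 ≤
      starWeights e J (γ p) (κ p) X G.h (G.xval ∘ o) (G.yval ∘ o) ℓ t := fun J p o =>
    G.weights_nonneg hc hC hX (hγ0 p) (hκ0 p).le o
  induction J using Finset.induction_on with
  | empty => exact fun o _ t => G.root_all_of_cheap hc hC hM hX (hγ0 _) (hκ0 _).le hκm o t
  | insert i J hi ih =>
    intro o ho
    rw [Finset.card_insert_of_notMem hi]
    set p := J.card with hp
    have hJ : ∀ j, j ≠ i → (j ∈ J ↔ j ∈ insert i J) := fun j hj => by simp [hj]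
    have hoJ : ∀ q, ∀ j ∈ J, Function.update o i q j = 0 := fun q j hj => by
      rw [Function.update_of_ne (fun h : j = i => hi (h ▸ hj)), ho j (Finset.mem_insert_of_mem hj)]
    set W := starWeights e (insert i J) (γ (p + 1)) (κ (p + 1)) X G.h (G.xval ∘ o) (G.yval ∘ o)
      with hWdef
    have hprof : ∀ (J' : Finset (Leaf k)) (ta : ℝ) (q : G.Index),
        (∀ j, j ≠ i → (j ∈ J' ↔ j ∈ insert i J)) →
        (ta = if i ∈ J' then γ (p + 1) else κ (p + 1)) →
        pairProfile W (e (Sum.inl i)) (e (Sum.inr i)) k i ta (κ (p + 1)) 0 (G.xval q) (G.yval q)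
          ∅ = sumProfile (starWeights e J' (γ (p + 1)) (κ (p + 1)) X G.h
            (G.xval ∘ Function.update o i q) (G.yval ∘ Function.update o i q)) := by
      intro J' ta q h1 h2
      rw [pairProfile_zero, hWdef, pairWeights_starWeights h1 h2, Function.comp_update,
        Function.comp_update]
      rfl
    -- While the first task of leaf i is still cheap, the induction hypothesis covers every grid
    -- cost of that leaf; this is why it quantifies over all `o`.
    have hcheap : ∀ q t, M.alloc (pairProfile W (e (Sum.inl i)) (e (Sum.inr i)) k i (κ (p + 1))
        (κ (p + 1)) 0 (G.xval q) (G.yval q) ∅) t = k := by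
      intro q t
      rw [hprof J _ q hJ (by simp [hi])]
      refine hT.root_all (hnn J p _) (hnn J (p + 1) _) (fun ℓ hℓ => ?_)
        (ih (Function.update o i q) (hoJ q)) (fun t _ => ?_) t
      · rw [starWeights_of_ne hℓ, starWeights_of_ne hℓ]
      · rw [starWeights_root, starWeights_root]
        exact rootWeights_lt (hγ p.lt_succ_self) (hκ p.lt_succ_self) t
    have hΓ1 : 1 ≤ Γ := (hγ1 0).trans (hγΓ 0)
    have hS : (M.pairModel W (e (Sum.inl i)) (e (Sum.inr i)) k i).Sound k i ε G.A c C G.h := by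
      refine Mechanism.pairModel_sound (e.injective.ne Sum.inl_ne_inr) i.2 (hnn _ _ _)
        (by linarith) ?_ (fun z hzk hzi => ?_) (fun z hzk hzi => ?_) hT hM
      · refine (Finset.sum_le_card_nsmul _ _ Γ fun t _ => ?_).trans (by simpa using hCΓ)
        rw [starWeights_root]
        exact rootWeights_le (hγΓ _) ((hκ1 _).trans hΓ1) t
      · rw [starWeights_of_ne hzk, leafWeights_inl,
          if_neg fun h => hzi (congrArg Subtype.val h).symm]
        exact hX _ _
      · rw [starWeights_of_ne hzk, leafWeights_inr,
          if_neg fun h => hzi (congrArg Subtype.val h).symm]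
    have hkeep := hS.root_keeps (G.scales hc hC (hκ0 (p + 1)) (hκ1 (p + 1))) i.2 G.hw G.hMx G.hMd
      G.hd1 G.hd (hγ0 (p + 1)) (hγΓ (p + 1)) G.hs G.hY' G.hQ1 G.hQ G.hb0 G.hb G.hAb G.hAb2 hε G.hT
      (fun j l h1 h2 h3 => by
        obtain ⟨q, hq1, hq2⟩ := G.exists_index h1 h2 h3
        rw [← hq1, ← hq2]
        exact ⟨hcheap q _, hcheap q _⟩)
      (by
        have h0 := hcheap 0
        rw [G.xval_zero, G.yval_zero] at h0
        exact ⟨h0 _, h0 _⟩)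
      (fun β hβ j l h1 h2 h3 σ _ _ z hzk hzi hzσ => by
        obtain ⟨q, hq1, hq2⟩ := G.exists_index h1 h2 h3
        rw [← hq1, ← hq2]
        have := hgood i (insert i J) o q β hβ σ z hzk hzi hzσ
        rw [Finset.card_insert_of_notMem hi] at this
        exact this)
    have hkeep' : M.alloc (sumProfile W) (e (Sum.inl i)) = k := by
      have := hprof (insert i J) _ 0 (fun _ _ => Iff.rfl) rfl
      rw [if_pos (Finset.mem_insert_self i J), G.xval_zero, G.yval_zero,
        Function.update_eq_self_iff.2 (ho i (Finset.mem_insert_self i J)).symm] at this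
      rw [hWdef, ← this]
      exact hkeep
    -- Only the first task of leaf i has become dearer, and the root keeps it by `hkeep'`. All the
    -- others are strictly cheaper, because γ and κ decrease.
    refine hT.root_all (hnn J p o) (hnn _ (p + 1) o) (fun ℓ hℓ => ?_)
      (ih o fun j hj => ho j (Finset.mem_insert_of_mem hj)) (fun t ht => ?_)
    · rw [hWdef, starWeights_of_ne hℓ, starWeights_of_ne hℓ]
    · rw [hWdef, starWeights_root, starWeights_root,
        rootWeights_congr (fun j hj => (hJ j hj).symm)
          (fun h : t = e (Sum.inl i) => ht (by rwa [h]))]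
      exact rootWeights_lt (hγ p.lt_succ_self) (hκ p.lt_succ_self) t

end Claim

/-! ### The bound on the ratio -/

lemma card_leaf (k : Fin n) : Fintype.card (Leaf k) = n - 1 := by
  simp [Leaf, Fintype.card_subtype_compl]

/-- The ratio of a mechanism is at least `1`. -/
lemma Mechanism.ApproxOn.one_le (hm : 0 < m) (k : Fin n) {M : Mechanism n m} {c : ℝ}
    (hM : M.ApproxOn c (additiveDomain n m)) : 1 ≤ c := by
  have : Nonempty (Fin n) := ⟨k⟩
  set P : Profile n m := sumProfile fun _ _ => 1 with hP
  have h1 := hM P fun k => isAdditive_sum _ fun _ => zero_le_one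
  have h2 : 1 ≤ opt P := by
    refine le_ciInf fun a => le_trans ?_ (le_makespan P a (a ⟨0, hm⟩))
    have : 0 < (a.bundle (a ⟨0, hm⟩)).card :=
      Finset.card_pos.2 ⟨⟨0, hm⟩, by simp [Allocation.bundle]⟩
    simp only [hP, sumProfile, Finset.sum_const, nsmul_eq_mul, mul_one]
    exact_mod_cast this
  have h3 := (opt_le P (M.alloc P)).trans h1
  by_contra! hc
  nlinarith

section Final

variable {k : Fin n} {e : Leaf k ⊕ Leaf k ↪ Fin m} {γ κ h : ℝ} {X : Leaf k → Leaf k → ℝ}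
  {x y : Leaf k → ℝ}

lemma le_sum_rootWeights (hγ : 1 ≤ γ) (hκ : 0 ≤ κ) :
    ((n - 1 : ℕ) : ℝ) ≤ ∑ t, rootWeights e Finset.univ γ κ t := by
  have hinj : Function.Injective fun j : Leaf k => e (Sum.inl j) :=
    e.injective.comp Sum.inl_injective
  calc ((n - 1 : ℕ) : ℝ) = ∑ _j : Leaf k, (1 : ℝ) := by simp
    _ ≤ ∑ j : Leaf k, rootWeights e Finset.univ γ κ (e (Sum.inl j)) :=
        Finset.sum_le_sum fun j _ => by simpa using hγ
    _ = ∑ t ∈ Finset.univ.map ⟨_, hinj⟩, rootWeights e Finset.univ γ κ t := by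
        rw [Finset.sum_map]; rfl
    _ ≤ _ := Finset.sum_le_sum_of_subset_of_nonneg (Finset.subset_univ _) fun t _ _ =>
        le_rootWeights (zero_le_one.trans hγ) hκ t

/-- The allocation of the first tasks to their leaves and of all other tasks to the root. -/
noncomputable def leafAllocation (e : Leaf k ⊕ Leaf k ↪ Fin m) : Allocation n m :=
  Function.extend e (Sum.elim (fun j => j.1) fun _ => k) fun _ => k

lemma leafAllocation_eq_root {t : Fin m} (ht : leafAllocation e t = k) (J : Finset (Leaf k)) :
    rootWeights e J γ κ t = κ := by
  by_cases hu : ∃ u, e u = t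
  · obtain ⟨j | j, rfl⟩ := hu
    · simp only [leafAllocation, e.injective.extend_apply, Sum.elim_inl] at ht
      exact absurd ht j.2
    · simp
  · exact rootWeights_of_notMem hu

lemma leafAllocation_eq_leaf {t : Fin m} {ℓ : Leaf k} :
    leafAllocation e t = ℓ ↔ t = e (Sum.inl ℓ) := by
  constructor
  · intro ht
    by_cases hu : ∃ u, e u = t
    · obtain ⟨j | j, rfl⟩ := hu
      · simp only [leafAllocation, e.injective.extend_apply, Sum.elim_inl] at ht
        rw [Subtype.ext ht]
      · simp only [leafAllocation, e.injective.extend_apply, Sum.elim_inr] at ht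
        exact absurd ht.symm ℓ.2
    · rw [leafAllocation, Function.extend_apply' _ _ _ hu] at ht
      exact absurd ht.symm ℓ.2
  · rintro rfl
    simp [leafAllocation, e.injective.extend_apply]

lemma leafAllocation_load {x₀ : ℝ} (hκ : 0 ≤ κ) (hκm : m * κ ≤ x₀) (hx : ∀ j, x j = x₀)
    (J : Finset (Leaf k)) (ℓ : Fin n) :
    ∑ t, starWeights e J γ κ X h x y ℓ t * (if leafAllocation e t = ℓ then 1 else 0) ≤ x₀ := by
  by_cases hℓ : ℓ = k
  · subst hℓ
    refine le_trans (Finset.sum_le_card_nsmul _ _ κ fun t _ => ?_) (by simpa using hκm)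
    split_ifs with ht
    · rw [starWeights_root, leafAllocation_eq_root ht, mul_one]
    · simpa using hκ
  · have : ∀ t, leafAllocation e t = ℓ ↔ t = e (Sum.inl ⟨ℓ, hℓ⟩) := fun t =>
      leafAllocation_eq_leaf (ℓ := ⟨ℓ, hℓ⟩)
    simp [this, starWeights_of_ne hℓ, hx]

end Final

/-- A lower bound for the square of the ratio, for mechanisms that are truthful for one machine with
a nearly additive cost. -/
theorem sub_one_le_sq {ε c : ℝ} (hn : 2 ≤ n) (hm : 2 * (n - 1) ≤ m) (k : Fin n) (hε : 0 < ε)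
    (H : ∀ E, 0 < E → ∃ M : Mechanism n m,
      M.TruthfulOn (oneMachineDomain k (nearAdditive m ε E)) ∧ M.ApproxOn c (additiveDomain n m)) :
    ((n - 1 : ℕ) : ℝ) ≤ c ^ 2 := by
  have hm0 : 0 < m := by omega
  have hm1 : (1 : ℝ) ≤ m := by exact_mod_cast hm0
  have hc : 1 ≤ c := by
    obtain ⟨M, -, hM⟩ := H 1 one_pos
    exact hM.one_le hm0 k
  have hc0 : 0 < c := by linarith
  by_contra! hlt
  -- The bound x₀ < (n - 1) / c is for the final contradiction, and x₀ > c leaves room for some Γ >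
  -- 1 with c * Γ < x₀.
  obtain ⟨x₀, hx1, hx2⟩ := exists_between (show c < ((n - 1 : ℕ) : ℝ) / c by
    rw [lt_div_iff₀ hc0]; nlinarith)
  obtain ⟨Γ, hΓ1, hΓ2⟩ := exists_between (show 1 < x₀ / c by rwa [one_lt_div hc0])
  rw [lt_div_iff₀ hc0] at hx2 hΓ2
  have hC : 0 ≤ m * Γ := by positivity
  obtain ⟨G⟩ := exists_grid n hε hc hC (by linarith : 0 ≤ Γ) (by linarith : c * Γ < x₀)
  have hx₀ := G.hw.trans G.w_lt
  -- The size of the discount is known only once the grid is fixed, hence the quantifier over `E` in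
  -- `H`.
  obtain ⟨M, hT, hM⟩ := H G.A (by nlinarith [G.hA])
  obtain ⟨e⟩ : Nonempty (Leaf k ⊕ Leaf k ↪ Fin m) := by
    rw [Function.Embedding.nonempty_iff_card_le]
    simp only [Fintype.card_sum, card_leaf, Fintype.card_fin]
    omega
  set κ₀ : ℝ := min G.w 1 / (2 * c * m) with hκ₀
  have hmin : 0 < min G.w 1 := lt_min G.hw one_pos
  have hκ₀0 : 0 < κ₀ := by positivity
  have hκ₀m : c * (m * κ₀) = min G.w 1 / 2 := by rw [hκ₀]; field_simp
  have hmκ : m * κ₀ ≤ c * (m * κ₀) := le_mul_of_one_le_left (by positivity) hc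
  have hκκ : κ₀ ≤ m * κ₀ := le_mul_of_one_le_left hκ₀0.le hm1
  have hmin1 := min_le_right G.w 1
  have hminw := min_le_left G.w 1
  have hanti : ∀ {a : ℝ}, 0 < a → StrictAnti fun p : ℕ => a / ((p : ℝ) + 1) := fun ha p q hpq => by
    have : (p : ℝ) < q := by exact_mod_cast hpq
    exact div_lt_div_of_pos_left ha (by positivity) (by linarith)
  have hdiv : ∀ {a : ℝ}, 0 < a → ∀ p : ℕ, a / ((p : ℝ) + 1) ≤ a := fun ha p =>
    div_le_self ha.le (by linarith [p.cast_nonneg (α := ℝ)])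
  have hκ0 : ∀ p : ℕ, 0 < κ₀ / ((p : ℝ) + 1) := fun p => by positivity
  have hγ1 : ∀ p : ℕ, 1 ≤ 1 + (Γ - 1) / ((p : ℝ) + 1) := fun p =>
    le_add_of_nonneg_right (div_nonneg (by linarith) (by positivity))
  obtain ⟨X, hX, hall⟩ := G.root_all (e := e) hε.le hc hC le_rfl hT hM
    (γ := fun p => 1 + (Γ - 1) / ((p : ℝ) + 1)) (κ := fun p => κ₀ / ((p : ℝ) + 1))
    ((hanti (by linarith)).const_add 1) (hanti hκ₀0) hγ1
    (fun p => by linarith [hdiv (sub_pos.2 hΓ1) p]) hκ0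
    (fun p => by linarith [hdiv hκ₀0 p]) (by
      simp only [Nat.cast_zero, zero_add, div_one]
      linarith)
  specialize hall Finset.univ 0 (fun _ _ => rfl)
  set p := (Finset.univ : Finset (Leaf k)).card
  -- Each leaf takes its first task, at cost x₀, while the root's remaining tasks cost at most m *
  -- κ₀ < x₀ in total.
  have hload := hM.load_le hc0.le (G.weights_nonneg (e := e) hc hC hX
    (zero_le_one.trans (hγ1 p)) (hκ0 p).le 0) (leafAllocation e)
    (leafAllocation_load (x₀ := x₀) (hκ0 p).le (by nlinarith [hdiv hκ₀0 p]) (fun j => G.xval_zero)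
      Finset.univ) k
  have hone : ∀ t, M.alloc (fun ℓ S => ∑ t ∈ S, starWeights e Finset.univ
      (1 + (Γ - 1) / ((p : ℝ) + 1)) (κ₀ / ((p : ℝ) + 1)) X G.h (G.xval ∘ 0) (G.yval ∘ 0) ℓ t) t =
      k := hall
  simp only [hone, if_true, mul_one, starWeights_root] at hload
  linarith [le_sum_rootWeights (e := e) (hγ1 p) (hκ0 p).le]

/-! ### Reductions between classes of costs, and change of units -/

lemma Mechanism.TruthfulOn.mono {M : Mechanism n m} {D D' : Fin n → Set (Cost m)}
    (hM : M.TruthfulOn D) (h : ∀ i, D' i ⊆ D i) : M.TruthfulOn D' :=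
  fun i b hb v hv => hM i b (fun k => h k (hb k)) v (h i hv)

lemma Mechanism.ApproxOn.mono {M : Mechanism n m} {c : ℝ} {D D' : Fin n → Set (Cost m)}
    (hM : M.ApproxOn c D) (h : ∀ i, D' i ⊆ D i) : M.ApproxOn c D' :=
  fun t ht => hM t fun k => h k (ht k)

lemma oneMachineDomain_mono (k : Fin n) {C C' : Set (Cost m)} (h : C' ⊆ C) (i : Fin n) :
    oneMachineDomain k C' i ⊆ oneMachineDomain k C i :=
  fun _ hv => ⟨fun hi => h (hv.1 hi), hv.2⟩

lemma IsAdditive.isSubmodular {v : Cost m} (hv : IsAdditive v) : IsSubmodular v :=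
  ⟨hv.1, fun S T => by
    rw [hv.2 (S ∪ T), hv.2 (S ∩ T), hv.2 S, hv.2 T, Finset.sum_union_inter]⟩

section Discount

variable {w : Fin m → ℝ} {a b : Fin m}

lemma discount_singleton (hab : a ≠ b) (j : Fin m) :
    (∑ t ∈ {j}, w t - if a ∈ ({j} : Finset (Fin m)) ∧ b ∈ ({j} : Finset (Fin m)) then w a else 0) =
      w j := by
  have : ¬ (a ∈ ({j} : Finset (Fin m)) ∧ b ∈ ({j} : Finset (Fin m))) := by
    rintro ⟨h1, h2⟩
    rw [Finset.mem_singleton] at h1 h2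
    exact hab (h1.trans h2.symm)
  rw [if_neg this]
  simp

/-- The subtracted discount is supermodular. Monotonicity survives because it never exceeds the cost
of whichever of a, b completes the pair. -/
lemma isSubmodular_discount (hw : ∀ t, 0 ≤ w t) (hle : w a ≤ w b) :
    IsSubmodular fun S : Finset (Fin m) => ∑ t ∈ S, w t - if a ∈ S ∧ b ∈ S then w a else 0 := by
  refine ⟨⟨by simp, fun S T hST => ?_⟩, fun S T => ?_⟩
  · beta_reduce
    have hsum := Finset.sum_sdiff hST (f := w)
    have hnn : 0 ≤ ∑ t ∈ T \ S, w t := Finset.sum_nonneg fun t _ => hw t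
    have hs : ∀ t ∈ T, t ∉ S → w t ≤ ∑ t ∈ T \ S, w t := fun t h1 h2 =>
      Finset.single_le_sum (fun t _ => hw t) (Finset.mem_sdiff.2 ⟨h1, h2⟩)
    by_cases hT : a ∈ T ∧ b ∈ T
    · by_cases hS : a ∈ S ∧ b ∈ S
      · simp only [hT, hS, and_self, if_true]; linarith
      · rw [if_neg hS, if_pos hT]
        rw [not_and_or] at hS
        rcases hS with hS | hS
        · linarith [hs a hT.1 hS]
        · linarith [hs b hT.2 hS]
    · rw [if_neg hT, if_neg fun h => hT ⟨hST h.1, hST h.2⟩]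
      linarith
  · have hsum := Finset.sum_union_inter (s₁ := S) (s₂ := T) (f := w)
    have ha := hw a
    have hdisc : (if a ∈ S ∧ b ∈ S then w a else 0) + (if a ∈ T ∧ b ∈ T then w a else 0) ≤
        (if a ∈ S ∪ T ∧ b ∈ S ∪ T then w a else 0) +
          (if a ∈ S ∩ T ∧ b ∈ S ∩ T then w a else 0) := by
      simp only [Finset.mem_union, Finset.mem_inter]
      by_cases h1 : a ∈ S <;> by_cases h2 : b ∈ S <;> by_cases h3 : a ∈ T <;>
        by_cases h4 : b ∈ T <;> simp [h1, h2, h3, h4, ha]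
    linarith

end Discount

lemma nearAdditive_submodular {ε E : ℝ} (hε1 : ε ≤ 1) {v : Cost m}
    (hv : v ∈ nearAdditive m ε E) : IsSubmodular v := by
  rcases hv with hv | ⟨w, a, b, -, hw, -, hε, rfl⟩
  · exact hv.isSubmodular
  · exact isSubmodular_discount hw (hε.trans (mul_le_of_le_one_left (hw b) hε1))

lemma nearAdditive_isEpsAdditive {ε E : ℝ} (hE : 0 ≤ E) {v : Cost m}
    (hv : v ∈ nearAdditive m ε E) : IsEpsAdditive E v := by
  intro S
  rcases hv with hv | ⟨w, a, b, hab, hw, hwE, -, rfl⟩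
  · rw [hv.2 S]
    constructor <;> linarith
  · simp only [discount_singleton hab]
    have := hw a
    split_ifs <;> constructor <;> linarith

/-- The discount occurs only when b is present, and then it is at most ε times the cost of b alone.
-/
lemma nearAdditive_isMulEpsAdditive {ε ε' E : ℝ} (hε : 0 ≤ ε) (hεε : ε' ≤ ε) {v : Cost m}
    (hv : v ∈ nearAdditive m ε' E) : IsMulEpsAdditive ε v := by
  intro S
  rcases hv with hv | ⟨w, a, b, hab, hw, -, hε', rfl⟩
  · rw [hv.2 S]
    have h0 : 0 ≤ ∑ j ∈ S, v {j} := by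
      rw [← hv.2 S, ← hv.1.1]
      exact hv.1.2 _ _ (Finset.empty_subset S)
    constructor <;> nlinarith
  · simp only [discount_singleton hab]
    have ha := hw a
    have h0 : 0 ≤ ∑ j ∈ S, w j := Finset.sum_nonneg fun t _ => hw t
    have h1 := mul_nonneg hε h0
    split_ifs with hS
    · have h2 : w b ≤ ∑ j ∈ S, w j := Finset.single_le_sum (fun t _ => hw t) hS.2
      have h3 : w a ≤ ε * ∑ j ∈ S, w j :=
        hε'.trans (mul_le_mul hεε h2 (hw b) hε)
      constructor <;> linarith
    · constructor <;> linarith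

/-- The mechanism that measures costs in other units. -/
noncomputable def Mechanism.scale (M : Mechanism n m) (u : ℝ) : Mechanism n m where
  alloc t := M.alloc (u • t)
  pay t i := M.pay (u • t) i / u

lemma Mechanism.TruthfulOn.scale {M : Mechanism n m} {D D' : Fin n → Set (Cost m)}
    (hM : M.TruthfulOn D) {u : ℝ} (hu : 0 < u) (hD : ∀ i, ∀ v ∈ D' i, u • v ∈ D i) :
    (M.scale u).TruthfulOn D' := by
  intro i b hb v hv
  have h := hM i (u • b) (fun k => hD k _ (hb k)) (u • v) (hD i v hv)
  rw [show Function.update (u • b) i (u • v) = u • Function.update b i v from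
    (Function.update_smul u b i v).symm ▸ rfl] at h
  simp only [Mechanism.utility, Mechanism.scale, Pi.smul_apply, smul_eq_mul] at h ⊢
  rw [div_sub' hu.ne', div_sub' hu.ne']
  exact div_le_div_of_nonneg_right h hu.le

lemma makespan_smul {u : ℝ} (hu : 0 ≤ u) (t : Profile n m) (a : Allocation n m) :
    makespan (u • t) a = u * makespan t a := by
  simp only [makespan, Pi.smul_apply, smul_eq_mul, Real.mul_iSup_of_nonneg hu]

lemma opt_smul {u : ℝ} (hu : 0 ≤ u) (t : Profile n m) : opt (u • t) = u * opt t := by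
  simp only [opt, makespan_smul hu, Real.mul_iInf_of_nonneg hu]

lemma Mechanism.ApproxOn.scale {M : Mechanism n m} {c : ℝ} {D D' : Fin n → Set (Cost m)}
    (hM : M.ApproxOn c D) {u : ℝ} (hu : 0 < u) (hD : ∀ i, ∀ v ∈ D' i, u • v ∈ D i) :
    (M.scale u).ApproxOn c D' := by
  intro t ht
  have h := hM (u • t) fun k => hD k _ (ht k)
  rw [makespan_smul hu.le, opt_smul hu.le] at h
  refine le_of_mul_le_mul_left ?_ hu
  calc _ ≤ _ := h
    _ = _ := by ring

lemma IsCost.smul {v : Cost m} (hv : IsCost v) {u : ℝ} (hu : 0 ≤ u) : IsCost (u • v) :=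
  ⟨by simp [hv.1], fun S T hST => mul_le_mul_of_nonneg_left (hv.2 S T hST) hu⟩

lemma IsAdditive.smul {v : Cost m} (hv : IsAdditive v) {u : ℝ} (hu : 0 ≤ u) :
    IsAdditive (u • v) :=
  ⟨hv.1.smul hu, fun S => by
    simp only [Pi.smul_apply, smul_eq_mul, ← Finset.mul_sum]
    rw [hv.2 S]⟩

lemma IsSubmodular.smul {v : Cost m} (hv : IsSubmodular v) {u : ℝ} (hu : 0 ≤ u) :
    IsSubmodular (u • v) :=
  ⟨hv.1.smul hu, fun S T => by
    have := mul_le_mul_of_nonneg_left (hv.2 S T) hu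
    simp only [Pi.smul_apply, smul_eq_mul]
    linarith⟩

lemma IsEpsAdditive.smul {v : Cost m} {E : ℝ} (hv : IsEpsAdditive E v) {u : ℝ} (hu : 0 ≤ u) :
    IsEpsAdditive (u * E) (u • v) := fun S => by
  have h1 := mul_le_mul_of_nonneg_left (hv S).1 hu
  have h2 := mul_le_mul_of_nonneg_left (hv S).2 hu
  simp only [Pi.smul_apply, smul_eq_mul, ← Finset.mul_sum]
  constructor <;> linarith

lemma sqrt_le_of_sub_one_le_sq (hn : 2 ≤ n) (hm : 2 * (n - 1) ≤ m) (k : Fin n)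
    {M : Mechanism n m} {c : ℝ} (hM : M.ApproxOn c (additiveDomain n m))
    (h : ((n - 1 : ℕ) : ℝ) ≤ c ^ 2) : Real.sqrt ((n : ℝ) - 1) ≤ c := by
  have hc : 1 ≤ c := hM.one_le (by omega) k
  rw [Nat.cast_sub (by omega), Nat.cast_one] at h
  exact Real.sqrt_le_iff.2 ⟨by linarith, h⟩

theorem sqrt_le_of_submodular (hn : 2 ≤ n) (hm : 2 * (n - 1) ≤ m) (k : Fin n)
    {M : Mechanism n m} {c : ℝ} (hT : M.TruthfulOn (oneMachineDomain k {v | IsSubmodular v}))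
    (hM : M.ApproxOn c (additiveDomain n m)) : Real.sqrt ((n : ℝ) - 1) ≤ c :=
  sqrt_le_of_sub_one_le_sq hn hm k hM <| sub_one_le_sq hn hm k one_pos fun _ _ =>
    ⟨M, hT.mono (oneMachineDomain_mono k fun _ hv => nearAdditive_submodular le_rfl hv), hM⟩

theorem sqrt_le_of_isMulEpsAdditive (hn : 2 ≤ n) (hm : 2 * (n - 1) ≤ m) (k : Fin n)
    {M : Mechanism n m} {c ε : ℝ} (hε : 0 < ε)
    (hT : M.TruthfulOn (oneMachineDomain k {v | IsSubmodular v ∧ IsMulEpsAdditive ε v}))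
    (hM : M.ApproxOn c (additiveDomain n m)) : Real.sqrt ((n : ℝ) - 1) ≤ c :=
  sqrt_le_of_sub_one_le_sq hn hm k hM <| sub_one_le_sq hn hm k (lt_min hε one_pos) fun _ _ =>
    ⟨M, hT.mono (oneMachineDomain_mono k fun _ hv => ⟨nearAdditive_submodular (min_le_right _ _) hv,
      nearAdditive_isMulEpsAdditive hε.le (min_le_left _ _) hv⟩), hM⟩

theorem sqrt_le_of_isEpsAdditive (hn : 2 ≤ n) (hm : 2 * (n - 1) ≤ m) (k : Fin n)
    {M : Mechanism n m} {c ε : ℝ} (hε : 0 < ε)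
    (hT : M.TruthfulOn (oneMachineDomain k {v | IsSubmodular v ∧ IsEpsAdditive ε v}))
    (hM : M.ApproxOn c (additiveDomain n m)) : Real.sqrt ((n : ℝ) - 1) ≤ c := by
  -- The discount may be as large as E. Measuring costs in other units shrinks it to ε and leaves
  -- the ratio unchanged.
  refine sqrt_le_of_sub_one_le_sq hn hm k hM <| sub_one_le_sq hn hm k one_pos fun E hE =>
    ⟨M.scale (ε / E), hT.scale (div_pos hε hE) fun i v hv => ⟨fun hi => ?_, fun hi => ?_⟩,
      hM.scale (div_pos hε hE) fun _ v hv => hv.smul (div_pos hε hE).le⟩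
  · have h := (nearAdditive_isEpsAdditive hE.le (hv.1 hi)).smul (div_pos hε hE).le
    rw [div_mul_cancel₀ _ hE.ne'] at h
    exact ⟨(nearAdditive_submodular le_rfl (hv.1 hi)).smul (div_pos hε hE).le, h⟩
  · exact (hv.2 hi).smul (div_pos hε hE).le

end Scheduling

theorem theorem1 (n m : ℕ) (hn : 2 ≤ n) (hm : 2 * (n - 1) ≤ m)
    (M : Scheduling.Mechanism n m) (c : ℝ) :
    -- truthful for submodular machines, ratio on submodular instances
    (M.TruthfulOn (Scheduling.submodularDomain n m) →
      M.ApproxOn c (Scheduling.submodularDomain n m) →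
      Real.sqrt ((n : ℝ) - 1) ≤ c) ∧
    -- truthful when one machine is submodular and the others additive, ratio on additive instances
    (∀ k : Fin n,
      M.TruthfulOn (Scheduling.oneMachineDomain k {v | Scheduling.IsSubmodular v}) →
      M.ApproxOn c (Scheduling.additiveDomain n m) →
      Real.sqrt ((n : ℝ) - 1) ≤ c) ∧
    -- the same, with the submodular machine within `ε` of being additive
    (∀ (k : Fin n) (ε : ℝ), 0 < ε →
      M.TruthfulOn (Scheduling.oneMachineDomain k
        {v | Scheduling.IsSubmodular v ∧ Scheduling.IsEpsAdditive ε v}) →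
      M.ApproxOn c (Scheduling.additiveDomain n m) →
      Real.sqrt ((n : ℝ) - 1) ≤ c) ∧
    -- the same, with the submodular machine within a factor `1 ± ε` of being additive
    (∀ (k : Fin n) (ε : ℝ), 0 < ε →
      M.TruthfulOn (Scheduling.oneMachineDomain k
        {v | Scheduling.IsSubmodular v ∧ Scheduling.IsMulEpsAdditive ε v}) →
      M.ApproxOn c (Scheduling.additiveDomain n m) →
      Real.sqrt ((n : ℝ) - 1) ≤ c) := by
  refine ⟨fun hT hM => ?_, fun k hT hM => ?_, fun k ε hε hT hM => ?_, fun k ε hε hT hM => ?_⟩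
  · refine Scheduling.sqrt_le_of_submodular hn hm ⟨0, by omega⟩ (hT.mono fun i v hv => ?_)
      (hM.mono fun i v hv => hv.isSubmodular)
    by_cases hi : i = ⟨0, by omega⟩
    · exact hv.1 hi
    · exact (hv.2 hi).isSubmodular
  · exact Scheduling.sqrt_le_of_submodular hn hm k hT hM
  · exact Scheduling.sqrt_le_of_isEpsAdditive hn hm k hε hT hM
  · exact Scheduling.sqrt_le_of_isMulEpsAdditive hn hm k hε hT hM
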